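/- **Setting.** Arms $a_1,a_2,\dots$ have means $p_1,p_2,\dots$ drawn i.i.d. from a reservoir distribution $\mu$ (a probability measure on $[0,1]$). Given the means, the $n$-th sample of arm $a_i$ returns a reward $r_{i,n}\sim\mathrm{Ber}(p_i)$, all rewards being independent. An $N$-sample algorithm takes exactly $N$ samples one at a time, choosing each sampled arm from the arms and rewards seen so far, and then outputs an arm $a_{i^*}$. Write $G_\mu(\tau)=\mathbb P^{p\sim\mu}[p\le\tau]$, $G_\mu^{-1}(q)=\inf\{\tau: G_\mu(\tau)\ge q\}$, $d_F(a,b)=\left|\int_a^b\frac{dx}{\sqrt{x(1-x)}}\right|$, $\theta(a)=\arccos(1-2a)$, and for $0<\beta<\alpha<1$ $$c_{\alpha,\beta}=\frac12\left(\int_\beta^\alpha\frac{dx}{\sqrt{x(1-x)}}\right)^2 .$$ **Algorithm.** The inputs are $N,\alpha,\beta$ and constants $\varrho,\varrho_1,\varrho_2\in(0,1)$. Put $b_0=\lceil\varrho_1\log^2N\rceil$, $k_0=\max\left(0,\lceil\log_{1+\varrho}(\log^4(N)/b_0)\rceil\right)$ and $b_k=\lceil b_0(1+\varrho)^k\rceil$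 for $k\ge 0$ (values at $N=1$ are immaterial). The arms are studied one at a time, in order. The arm under study is sampled repeatedly, and whenever its number of samples equals some $b_k$ it is tested through its current empirical average reward $\hat p$: * for $k\le k_0$ it is rejected if $\hat p\le \alpha-\varrho-\frac{k}{\sqrt{\log N}}$; * for $k=k_0+j$ with $j\ge1$ it is rejected if $\theta(\hat p)\le\theta(\alpha-2\varrho)-j\cdot\frac{d_F(\alpha,\beta)\,\varrho\,(1-\varrho_2)}{\log N}$ (here $\arccos$ of a number larger than $1$ is read as $0$). After a rejection the next arm is studied, with fresh samples. When $N$ samples have been collected the algorithm outputs the arm from which the last sample was taken. **Theorem.** Let $0<\beta<\alpha<1$. Then $$c_{\alpha,\beta}=\frac{\big(\arccos(1-2\alpha)-\arccos(1-2\beta)\big)^2}{2},$$ and there are constants $0<\varrho(N)<\varrho_1(N)<\varrho_2(N)<1$, depending only on $\alpha,\beta,N$ and tending to $0$ as $N\to\infty$, such that the $N$-sample algorithms $\mathcal A_N$ given by the algorithm above with $(\varrho,\varrho_1,\varrho_2)=(\varrho(N),\varrho_1(N),\varrho_2(N))$ have the following property. For every $\eta\in(0,1)$ and every sequence of reservoir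 distributions $\mu_N$ with $G_{\mu_N}^{-1}(1-\eta)\ge\alpha$ for all $N$, the arm $a_{i^*}$ output by $\mathcal A_N$ on the reservoir $\mu_N$ satisfies $$\limsup_{N\to\infty}\frac{\big(-\log\mathbb P[p_{i^*}<\beta]\big)\cdot\log^2N}{N}\ \ge\ c_{\alpha,\beta},$$ where $-\log 0=+\infty$. -/

import Mathlib

open MeasureTheory ProbabilityTheory Filter Topology

/-! ### Reservoirs -/

/-- The quantile function `G_μ⁻¹(q) = inf {τ : G_μ(τ) ≥ q}`, where `G_μ` is the cumulative
distribution function of `μ`. -/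
noncomputable def quantile (μ : Measure ℝ) (q : ℝ) : ℝ :=
  sInf {τ : ℝ | q ≤ cdf μ τ}

/-! ### The infinite-armed Bernoulli bandit -/

/-- A sample point of the environment: the mean `p i` of every arm `i`, and for every arm `i` and
every `n` a number in `[0, 1]` which generates the `n`-th reward of that arm. -/
abbrev Env : Type := (ℕ → ℝ) × (ℕ × ℕ → unitInterval)

/-- The law of the environment: the arm means are i.i.d. with law `μ`, and the reward seeds are
i.i.d. uniform on `[0, 1]`, independent of the arm means. -/
noncomputable def envLaw (μ : Measure ℝ) [IsProbabilityMeasure μ] : Measure Env :=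
  (Measure.infinitePi fun _ : ℕ => μ).prod
    (Measure.infinitePi fun _ : ℕ × ℕ => (volume : Measure unitInterval))

/-- The mean of arm `i`. -/
def armMean (ω : Env) (i : ℕ) : ℝ := ω.1 i

open Classical in
/-- The reward of the `n`-th sample (counted from `0`) of arm `i`: it is `true` (reward `1`) when the
seed is below the mean. Given the arm means, the rewards are independent and those of arm `i`
have law `Ber (p i)`. -/
noncomputable def armReward (ω : Env) (i n : ℕ) : Bool :=
  decide ((ω.2 (i, n) : ℝ) < ω.1 i)

/-- What an algorithm has seen so far: the list of sampled arms with the rewards observed,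
in chronological order. -/
abbrev History : Type := List (ℕ × Bool)

/-- A (deterministic) bandit algorithm: it chooses the next arm to sample from the history, and
the arm to output from the final history. -/
structure BanditAlgorithm where
  /-- the next arm to sample -/
  sample : History → ℕ
  /-- the arm to output -/
  output : History → ℕ

namespace BanditAlgorithm

/-- The history after `t` samples. The reward of a sample of arm `a` is the first reward
of arm `a` which has not been observed yet. -/
noncomputable def history (A : BanditAlgorithm) (ω : Env) : ℕ → History
  | 0 => []
  | t + 1 =>
    let h := A.history ω t
    let a := A.sample h
    h ++ [(a, armReward ω a (h.countP fun x => x.1 = a))]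

/-- The arm `i*` that the algorithm outputs after exactly `N` samples. -/
noncomputable def result (A : BanditAlgorithm) (N : ℕ) (ω : Env) : ℕ :=
  A.output (A.history ω N)

/-- The failure probability `ℙ[p_{i*} < β]` of the algorithm, run for exactly `N` samples on the
reservoir `μ`. -/
noncomputable def failureProb (A : BanditAlgorithm) (N : ℕ) (μ : Measure ℝ)
    [IsProbabilityMeasure μ] (β : ℝ) : ENNReal :=
  envLaw μ {ω | armMean ω (A.result N ω) < β}

end BanditAlgorithm

/-! ### Fisher information distance -/

/-- The Fisher information distance between Bernoulli parameters. -/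
noncomputable def fisherDist (a b : ℝ) : ℝ :=
  |∫ x in a..b, 1 / Real.sqrt (x * (1 - x))|

/-- The parametrization `θ(a) = arccos (1 - 2a)` of `[0, 1]`. -/
noncomputable def theta (a : ℝ) : ℝ := Real.arccos (1 - 2 * a)

/-- The rate constant `c_{α,β} = (∫_β^α dx / √(x (1 - x)))² / 2`. -/
noncomputable def rateConst (α β : ℝ) : ℝ :=
  (∫ x in β..α, 1 / Real.sqrt (x * (1 - x))) ^ 2 / 2

/-! ### The fixed budget algorithm -/

/-- The input of the fixed budget algorithm: the budget `N`, the values `α` and `β`, and the tuning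
constants `ϱ`, `ϱ₁`, `ϱ₂`. -/
structure Params where
  N : ℕ
  α : ℝ
  β : ℝ
  ϱ : ℝ
  ϱ₁ : ℝ
  ϱ₂ : ℝ

namespace Params

/-- `b₀ = ⌈ϱ₁ log² N⌉`. -/
noncomputable def b₀ (P : Params) : ℕ := ⌈P.ϱ₁ * Real.log P.N ^ 2⌉₊

/-- `k₀ = ⌈log_{1+ϱ} (log⁴ N / b₀)⌉`. -/
noncomputable def k₀ (P : Params) : ℕ :=
  ⌈Real.logb (1 + P.ϱ) (Real.log P.N ^ 4 / P.b₀)⌉₊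

/-- The checkpoints `b_k = ⌈b₀ (1 + ϱ)^k⌉`. -/
noncomputable def b (P : Params) (k : ℕ) : ℕ := ⌈P.b₀ * (1 + P.ϱ) ^ k⌉₊

/-- The rejection test at the `k`-th checkpoint for an arm with empirical average reward `x`.
For `k ≤ k₀` the average is compared with the threshold `α - ϱ - k / √(log N)`. For `k = k₀ + j`
with `j ≥ 1` the comparison is made in the coordinate `θ`. -/
def rejectTest (P : Params) (k : ℕ) (x : ℝ) : Prop :=
  (k ≤ P.k₀ ∧ x ≤ P.α - P.ϱ - k / Real.sqrt (Real.log P.N)) ∨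
  (∃ j : ℕ, 1 ≤ j ∧ k = P.k₀ + j ∧
    theta x ≤ theta (P.α - 2 * P.ϱ)
      - j * (fisherDist P.α P.β * P.ϱ * (1 - P.ϱ₂) / Real.log P.N))

end Params

/-- The state of the fixed budget algorithm: the arm under study, with the number of its samples and
its total reward so far. -/
structure ArmState where
  arm : ℕ
  count : ℕ
  total : ℕ

namespace Params

/-- An arm with `n` samples and total reward `R` is rejected if `n` is a checkpoint and the test
at that checkpoint rejects. -/
def rejects (P : Params) (n R : ℕ) : Prop :=
  ∃ k : ℕ, n = P.b k ∧ P.rejectTest k ((R : ℝ) / n)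

open Classical in
/-- Process one more reward of the arm under study; on rejection move on to the next arm. -/
noncomputable def step (P : Params) (s : ArmState) (r : Bool) : ArmState :=
  let n := s.count + 1
  let R := s.total + r.toNat
  if P.rejects n R then ⟨s.arm + 1, 0, 0⟩ else ⟨s.arm, n, R⟩

/-- The state after a given history, starting with a fresh arm `0`. -/
noncomputable def state (P : Params) (h : History) : ArmState :=
  h.foldl (fun s x => P.step s x.2) ⟨0, 0, 0⟩

/-- The fixed budget algorithm. It always samples the arm under study, and it outputs the arm which
was studied when the budget ran out, that is, the arm of the last sample. -/
noncomputable def algorithm (P : Params) : BanditAlgorithm where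
  sample h := (P.state h).arm
  output h := (h.getLast?.map Prod.fst).getD 0

end Params

/-! Fix `c` just below `c_{α,β}` and put `l = c / log² N`. The factor `exp (l N)` splits over the
arms: every rejected arm contributes `exp (l n)` with `n` the number of its samples, and the arm in
hand contributes its own weight. On failure it is therefore at most a sum over the final arm `I` of
`∏_{i<I} W_i · Z_I`, where `W` is the weight at rejection (zero without rejection) and `Z` the
weight of being still under study with a mean below `β` (`exp_le_sum_of_failure`). Independence of
the arms and Markov's inequality give `exp (l N) · ℙ[failure] ≤ ∑_I (E W)^I · E Z`
(`exp_mul_failureProb_le`). Once `E W ≤ 1` and `E Z ≤ e N`, the failure probability is at most `e N²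
exp (-l N)`, and the factor `e N²` is invisible on the scale `N / log² N`.

`E Z` is small because the thresholds stay above `β` throughout the budget (`le_angle`), so an arm
with mean below `β` pays more than `l` per sample to survive. For `E W`, a first rejection at any
checkpoint `k ≥ 1` costs more than `l b_k` in the exponent, whatever the mean: the arm has passed
the earlier, higher thresholds. Only the very first test can be failed cheaply, and not by an arm of
mean at least `α`. So the weight `W` has mean `1 + o(1)` for arms below `α` and `o(1)` for the
others, and the mass `η` of the latter absorbs the errors (`lintegral_rejectWeight_le_one`).

The constant comes from late checkpoints (`rejectEvent_near_le`). There the running average has to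
follow a threshold that falls, in the coordinate `θ`, at speed about `v = d_F(α,β) / log N` per unit
of `log n`. Since `θ` stabilises the variance, the cost is that of a Gaussian walk whose average at
time `s` lies `v log (n/s)` standard deviations above its average at time `n`, namely `(v² n / 2)
∫₀¹ (1 + log u)² du = v² n / 2 = c_{α,β} n / log² N`. `path_bound` realises this by an exponential
tilt along the optimal path, centred so that the mean of the arm drops out. Elsewhere crude tail
bounds suffice. -/

/-! ### Exponential bounds for Bernoulli sequences -/

/-- A sequence of independent Bernoulli variables of mean `p`. -/
structure IsBernoulliSeq {Ω : Type*} [MeasurableSpace Ω] (P : Measure Ω) (X : ℕ → Ω → ℝ)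
    (p : ℝ) : Prop where
  meas : ∀ n, Measurable (X n)
  indep : iIndepFun X P
  values : ∀ n ω, X n ω = 0 ∨ X n ω = 1
  mean : ∀ n, ∫ ω, X n ω ∂P = p

/-- Taylor's formula with `exp M` bounding the second derivative of `exp` on `[-M, M]`. The
difference of the two sides vanishes at `0`, and its derivative has the sign of the variable. -/
theorem exp_le_one_add_add_sq {y M : ℝ} (h : |y| ≤ M) :
    Real.exp y ≤ 1 + y + y ^ 2 / 2 * Real.exp M := by
  have hM : 0 ≤ M := (abs_nonneg y).trans h
  have hd : ∀ t : ℝ, HasDerivAt (fun t => 1 + t + t ^ 2 / 2 * Real.exp M - Real.exp t)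
      (1 + t * Real.exp M - Real.exp t) t := by
    intro t
    have h1 := (((hasDerivAt_id t).const_add 1).add
      (((hasDerivAt_pow 2 t).div_const 2).mul_const (Real.exp M))).sub (Real.hasDerivAt_exp t)
    refine h1.congr_deriv ?_
    simp
  have key : ∀ t : ℝ, t ≤ M → 0 ≤ t → Real.exp t ≤ 1 + t * Real.exp M := by
    intro t htM ht
    have h1 := Real.add_one_le_exp (-t)
    have h2 : Real.exp (-t) * Real.exp t = 1 := by rw [← Real.exp_add]; simp
    have h3 : Real.exp t ≤ Real.exp M := Real.exp_le_exp.mpr htM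
    nlinarith [Real.exp_pos t]
  have key2 : ∀ t : ℝ, t ≤ 0 → 1 + t * Real.exp M ≤ Real.exp t := by
    intro t ht
    have h1 := Real.add_one_le_exp t
    have h3 : 1 ≤ Real.exp M := Real.one_le_exp hM
    nlinarith
  have hf0 : (fun t : ℝ => 1 + t + t ^ 2 / 2 * Real.exp M - Real.exp t) 0 = 0 := by simp
  obtain ⟨hl, hr⟩ := abs_le.mp h
  suffices 0 ≤ (fun t : ℝ => 1 + t + t ^ 2 / 2 * Real.exp M - Real.exp t) y by
    simpa using this
  rw [← hf0]
  rcases le_total 0 y with hy | hy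
  · refine monotoneOn_of_hasDerivWithinAt_nonneg (convex_Icc 0 M)
      (fun t _ => (hd t).continuousAt.continuousWithinAt)
      (fun t _ => (hd t).hasDerivWithinAt) (fun t ht => ?_) ⟨le_rfl, hM⟩ ⟨hy, hr⟩ hy
    rw [interior_Icc] at ht
    linarith [key t ht.2.le ht.1.le]
  · refine antitoneOn_of_hasDerivWithinAt_nonpos (convex_Icc (-M) 0)
      (fun t _ => (hd t).continuousAt.continuousWithinAt)
      (fun t _ => (hd t).hasDerivWithinAt) (fun t ht => ?_) ⟨hl, hy⟩ ⟨by linarith, le_rfl⟩ hy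
    rw [interior_Icc] at ht
    linarith [key2 t ht.2.le]

/-- The variance is at most `1 / 4` and `e < 4`. This removes the variance factor from the crude
tail bounds. -/
theorem mul_one_sub_mul_exp_le (p : ℝ) {a : ℝ} (ha1 : a ≤ 1) :
    p * (1 - p) * Real.exp a ≤ 1 := by
  have h1 : Real.exp a ≤ Real.exp 1 := Real.exp_le_exp.mpr ha1
  have h2 := Real.exp_one_lt_d9
  have h3 : p * (1 - p) ≤ 1 / 4 := by nlinarith [sq_nonneg (p - 1 / 2)]
  nlinarith [Real.exp_pos a]

namespace IsBernoulliSeq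

variable {Ω : Type*} [MeasurableSpace Ω] {P : Measure Ω} [IsProbabilityMeasure P]
  {X : ℕ → Ω → ℝ} {p : ℝ}

theorem mean_mem (h : IsBernoulliSeq P X p) : 0 ≤ p ∧ p ≤ 1 := by
  have hI : Integrable (X 0) P := by
    refine Integrable.of_bound (h.meas 0).aestronglyMeasurable 1 (ae_of_all _ fun ω => ?_)
    rcases h.values 0 ω with h | h <;> simp [h]
  constructor
  · rw [← h.mean 0]
    refine integral_nonneg fun ω => ?_
    rcases h.values 0 ω with h | h <;> simp [h]
  · rw [← h.mean 0]
    calc ∫ ω, X 0 ω ∂P ≤ ∫ ω, (1 : ℝ) ∂P := by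
          refine integral_mono hI (integrable_const _) fun ω => ?_
          rcases h.values 0 ω with h | h <;> simp [h]
      _ = 1 := by simp

/-- As `X² = X`, the quadratic bound for `exp` is affine in `X` and integrates exactly. Keeping the
true variance `p (1 - p)`, up to a factor close to `1` for small tilts, is what the sharp constant
needs. -/
theorem integral_exp_le (h : IsBernoulliSeq P X p) (n : ℕ) {u M : ℝ} (hu : |u| ≤ M) :
    ∫ ω, Real.exp (u * (X n ω - p)) ∂P ≤ Real.exp (p * (1 - p) * Real.exp M * u ^ 2 / 2) := by
  obtain ⟨hp0, hp1⟩ := h.mean_mem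
  have hI : Integrable (X n) P := by
    refine Integrable.of_bound (h.meas n).aestronglyMeasurable 1 (ae_of_all _ fun ω => ?_)
    rcases h.values n ω with h | h <;> simp [h]
  have hpt : ∀ ω, Real.exp (u * (X n ω - p)) ≤
      (1 - u * p + u ^ 2 * p ^ 2 / 2 * Real.exp M) +
        (u + u ^ 2 * (1 - 2 * p) / 2 * Real.exp M) * X n ω := by
    intro ω
    have hX : X n ω ^ 2 = X n ω := by
      rcases h.values n ω with h | h <;> simp [h]
    have hb : |u * (X n ω - p)| ≤ M := by
      rw [abs_mul]
      have : |X n ω - p| ≤ 1 := by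
        rw [abs_le]
        rcases h.values n ω with h | h <;> rw [h] <;> constructor <;> linarith
      calc |u| * |X n ω - p| ≤ |u| * 1 := by gcongr
        _ ≤ M := by linarith
    refine (exp_le_one_add_add_sq hb).trans (le_of_eq ?_)
    linear_combination (u ^ 2 / 2 * Real.exp M) * hX
  have hint : ∫ ω, Real.exp (u * (X n ω - p)) ∂P ≤
      ∫ ω, ((1 - u * p + u ^ 2 * p ^ 2 / 2 * Real.exp M) +
        (u + u ^ 2 * (1 - 2 * p) / 2 * Real.exp M) * X n ω) ∂P := by
    refine integral_mono_of_nonneg (ae_of_all _ fun ω => (Real.exp_pos _).le) ?_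
      (ae_of_all _ hpt)
    exact (integrable_const _).add (hI.const_mul _)
  rw [integral_add (integrable_const _) (hI.const_mul _), integral_const_mul, h.mean n] at hint
  simp only [integral_const, probReal_univ, smul_eq_mul, one_mul] at hint
  refine hint.trans ?_
  refine le_trans (le_of_eq ?_) (Real.add_one_le_exp _)
  ring

theorem chernoff (h : IsBernoulliSeq P X p) (n : ℕ) (u : ℕ → ℝ) {M a : ℝ}
    (hu : ∀ j < n, |u j| ≤ M) :
    P.real {ω | a ≤ ∑ j ∈ Finset.range n, u j * (X j ω - p)} ≤
      Real.exp (-a + p * (1 - p) * Real.exp M * (∑ j ∈ Finset.range n, u j ^ 2) / 2) := by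
  have hmY : ∀ j, Measurable (fun ω => u j * (X j ω - p)) := fun j =>
    ((h.meas j).sub_const p).const_mul _
  have hind : iIndepFun (fun j ω => u j * (X j ω - p)) P :=
    h.indep.comp (fun j x => u j * (x - p)) fun j => by fun_prop
  have hsum := hind.mgf_sum (t := 1) hmY (Finset.range n)
  have hb : ∀ ω, |∑ j ∈ Finset.range n, u j * (X j ω - p)| ≤ ∑ j ∈ Finset.range n, |u j| := by
    obtain ⟨hp0, hp1⟩ := h.mean_mem
    intro ω
    refine (Finset.abs_sum_le_sum_abs _ _).trans (Finset.sum_le_sum fun j _ => ?_)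
    rw [abs_mul]
    refine mul_le_of_le_one_right (abs_nonneg _) ?_
    rw [abs_le]
    rcases h.values j ω with h | h <;> rw [h] <;> constructor <;> linarith
  have hint : Integrable
      (fun ω => Real.exp (1 * (∑ j ∈ Finset.range n, fun ω => u j * (X j ω - p)) ω)) P := by
    refine Integrable.of_bound ?_ (Real.exp (∑ j ∈ Finset.range n, |u j|)) (ae_of_all _ fun ω => ?_)
    · refine Measurable.aestronglyMeasurable ?_
      refine Real.measurable_exp.comp (Measurable.const_mul ?_ 1)
      simpa [Finset.sum_fn] using Finset.measurable_sum (Finset.range n) fun j _ => hmY j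
    · rw [Real.norm_eq_abs, Real.abs_exp, one_mul, Finset.sum_apply]
      exact Real.exp_le_exp.mpr ((le_abs_self _).trans (hb ω))
  have := measure_ge_le_exp_mul_mgf a zero_le_one hint
  rw [hsum] at this
  simp only [Finset.sum_apply] at this
  refine this.trans ?_
  rw [Real.exp_add, neg_one_mul]
  refine mul_le_mul_of_nonneg_left ?_ (Real.exp_pos _).le
  rw [Finset.mul_sum, Finset.sum_div, Real.exp_sum]
  refine Finset.prod_le_prod (fun j _ => mgf_nonneg) fun j hj => ?_
  simpa [mgf] using h.integral_exp_le j (hu j (Finset.mem_range.mp hj))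

theorem upper_tail (h : IsBernoulliSeq P X p) (n : ℕ) {x a : ℝ} (ha0 : 0 ≤ a) (ha1 : a ≤ 1)
    (hx : p + a ≤ x) :
    P.real {ω | x * n ≤ ∑ j ∈ Finset.range n, X j ω} ≤ Real.exp (-(n * a ^ 2 / 2)) := by
  have hn : (0 : ℝ) ≤ n := n.cast_nonneg
  refine (measureReal_mono ?_).trans
    ((h.chernoff n (fun _ => a) (M := a) (a := a ^ 2 * n) fun j _ => (abs_of_nonneg ha0).le).trans
      (Real.exp_le_exp.mpr ?_))
  · intro ω hω
    simp only [Set.mem_ofPred_eq, mul_sub, Finset.sum_sub_distrib, Finset.sum_const,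
      Finset.card_range, nsmul_eq_mul, ← Finset.mul_sum] at hω ⊢
    nlinarith [mul_nonneg ha0 hn]
  · have := mul_one_sub_mul_exp_le p ha1
    simp only [Finset.sum_const, Finset.card_range, nsmul_eq_mul]
    nlinarith [mul_nonneg hn (sq_nonneg a)]

theorem lower_tail (h : IsBernoulliSeq P X p) (n : ℕ) {x a : ℝ} (ha0 : 0 ≤ a) (ha1 : a ≤ 1)
    (hx : x ≤ p - a) :
    P.real {ω | ∑ j ∈ Finset.range n, X j ω ≤ x * n} ≤ Real.exp (-(n * a ^ 2 / 2)) := by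
  have hn : (0 : ℝ) ≤ n := n.cast_nonneg
  refine (measureReal_mono ?_).trans
    ((h.chernoff n (fun _ => -a) (M := a) (a := a ^ 2 * n) fun j _ => by
      rw [abs_neg, abs_of_nonneg ha0]).trans (Real.exp_le_exp.mpr ?_))
  · intro ω hω
    simp only [Set.mem_ofPred_eq, mul_sub, Finset.sum_sub_distrib, Finset.sum_const,
      Finset.card_range, nsmul_eq_mul, ← Finset.mul_sum] at hω ⊢
    nlinarith [mul_nonneg ha0 hn]
  · have := mul_one_sub_mul_exp_le p ha1
    simp only [Finset.sum_const, Finset.card_range, nsmul_eq_mul]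
    nlinarith [mul_nonneg hn (sq_nonneg a)]

/-- The mean lies on one side of the midpoint of `x₁` and `x₂`, so one of the two averages is off by
at least half the gap. The bound is thus free of `p`. -/
theorem two_point (h : IsBernoulliSeq P X p) {n₁ n₂ : ℕ} (hn : n₁ ≤ n₂) {x₁ x₂ : ℝ}
    (hx : x₂ ≤ x₁) (hx' : x₁ - x₂ ≤ 2) :
    P.real {ω | x₁ * n₁ ≤ ∑ j ∈ Finset.range n₁, X j ω ∧ ∑ j ∈ Finset.range n₂, X j ω ≤ x₂ * n₂} ≤
      Real.exp (-(n₁ * (x₁ - x₂) ^ 2 / 8)) := by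
  have hn' : (n₁ : ℝ) ≤ n₂ := by exact_mod_cast hn
  rcases le_total p ((x₁ + x₂) / 2) with hp | hp
  · refine (measureReal_mono fun ω hω => hω.1).trans
      ((h.upper_tail n₁ (a := (x₁ - x₂) / 2) (by linarith) (by linarith) (by linarith)).trans
        (le_of_eq ?_))
    congr 1
    ring
  · refine (measureReal_mono fun ω hω => hω.2).trans
      ((h.lower_tail n₂ (a := (x₁ - x₂) / 2) (by linarith) (by linarith) (by linarith)).trans
        (Real.exp_le_exp.mpr ?_))
    nlinarith [sq_nonneg (x₁ - x₂)]

end IsBernoulliSeq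

/-! ### Bernoulli walks held above a falling level -/

/-- Used twice: with indicators, to bound the sum of squared tilts by the linear gain, and with
sample numbers, to see that the resulting variance bound is nonnegative. -/
theorem sq_sum_le_two_mul_sum {e : ℕ → ℝ} {c : ℝ} (h0 : ∀ l, 0 ≤ e l) (h1 : ∀ l, e l ≤ c)
    (m : ℕ) :
    (∑ l ∈ Finset.range m, e l) ^ 2 ≤ 2 * c * ∑ l ∈ Finset.range m, ((l : ℝ) + 1) * e l := by
  induction m with
  | zero => simp
  | succ m ih =>
    have hS : ∑ l ∈ Finset.range m, e l ≤ m * c := by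
      calc ∑ l ∈ Finset.range m, e l ≤ ∑ l ∈ Finset.range m, c :=
            Finset.sum_le_sum fun l _ => h1 l
        _ = m * c := by simp
    rw [Finset.sum_range_succ, Finset.sum_range_succ]
    nlinarith [mul_le_mul_of_nonneg_right hS (h0 m), mul_le_mul_of_nonneg_right (h1 m) (h0 m),
      mul_nonneg (h0 m) ((h0 m).trans (h1 m))]

namespace IsBernoulliSeq

variable {Ω : Type*} [MeasurableSpace Ω] {P : Measure Ω} [IsProbabilityMeasure P]
  {X : ℕ → Ω → ℝ} {p : ℝ}

/-- The probability that the empirical average is at least `x l` at the earlier times `n l`,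
`1 ≤ l ≤ m`, and at most `x 0` at time `n 0`. -/
theorem path_bound (h : IsBernoulliSeq P X p) {n : ℕ → ℕ} (hn : Antitone n) (h0 : 0 < n 0)
    (m : ℕ) (x : ℕ → ℝ) {w v : ℝ} (hw : 0 ≤ w) (hv : p * (1 - p) ≤ v) :
    P.real {ω | (∀ l < m, x (l + 1) * n (l + 1) ≤ ∑ j ∈ Finset.range (n (l + 1)), X j ω) ∧
        ∑ j ∈ Finset.range (n 0), X j ω ≤ x 0 * n 0} ≤
      Real.exp (-(w * ∑ l ∈ Finset.range m, (x (l + 1) - x 0) * n (l + 1)) +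
        v * Real.exp (w * m) * w ^ 2 * (2 * ∑ l ∈ Finset.range m, ((l : ℝ) + 1) * n (l + 1) -
          (∑ l ∈ Finset.range m, (n (l + 1) : ℝ)) ^ 2 / n 0) / 2) := by
  have hn0 : (0 : ℝ) < n 0 := by exact_mod_cast h0
  set G : ℝ := ∑ l ∈ Finset.range m, (n (l + 1) : ℝ) with hG
  set D : ℝ := ∑ l ∈ Finset.range m, ((l : ℝ) + 1) * n (l + 1) with hD
  set e : ℕ → ℕ → ℝ := fun j l => if j < n (l + 1) then 1 else 0 with he
  set K : ℕ → ℝ := fun j => ∑ l ∈ Finset.range m, e j l with hK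
  have hGm : G ≤ m * n 0 := by
    calc G ≤ ∑ l ∈ Finset.range m, (n 0 : ℝ) :=
          Finset.sum_le_sum fun l _ => by exact_mod_cast hn (Nat.zero_le _)
      _ = m * n 0 := by simp
  have hG0 : 0 ≤ G := Finset.sum_nonneg fun l _ => Nat.cast_nonneg _
  have hKm : ∀ j, K j ≤ m := by
    intro j
    calc K j ≤ ∑ l ∈ Finset.range m, (1 : ℝ) :=
          Finset.sum_le_sum fun l _ => by simp only [he]; split_ifs <;> norm_num
      _ = m := by simp
  have hK0 : ∀ j, 0 ≤ K j := fun j =>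
    Finset.sum_nonneg fun l _ => by simp only [he]; split_ifs <;> norm_num
  have hswap : ∀ f : ℕ → ℝ, ∀ g : ℕ → ℝ,
      ∑ j ∈ Finset.range (n 0), (∑ l ∈ Finset.range m, g l * e j l) * f j =
      ∑ l ∈ Finset.range m, g l * ∑ j ∈ Finset.range (n (l + 1)), f j := by
    intro f g
    simp_rw [Finset.sum_mul]
    rw [Finset.sum_comm]
    refine Finset.sum_congr rfl fun l _ => ?_
    rw [Finset.mul_sum]
    simp only [he, mul_ite, mul_one, mul_zero, ite_mul, zero_mul]
    rw [← Finset.sum_filter]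
    refine Finset.sum_congr ?_ fun _ _ => rfl
    ext j
    simp only [Finset.mem_filter, Finset.mem_range]
    exact ⟨fun h => h.2, fun h => ⟨h.trans_le (hn (Nat.zero_le _)), h⟩⟩
  have hKf : ∀ f : ℕ → ℝ, ∑ j ∈ Finset.range (n 0), K j * f j =
      ∑ l ∈ Finset.range m, ∑ j ∈ Finset.range (n (l + 1)), f j := by
    intro f
    simpa using hswap f fun _ => 1
  have hKsum : ∑ j ∈ Finset.range (n 0), K j = G := by
    simpa using hKf fun _ => 1
  have hKsq : ∑ j ∈ Finset.range (n 0), K j ^ 2 ≤ 2 * D := by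
    calc ∑ j ∈ Finset.range (n 0), K j ^ 2
        ≤ ∑ j ∈ Finset.range (n 0), 2 * ∑ l ∈ Finset.range m, ((l : ℝ) + 1) * e j l :=
          Finset.sum_le_sum fun j _ => by
            simpa using sq_sum_le_two_mul_sum (e := e j) (c := 1)
              (fun l => by simp only [he]; split_ifs <;> simp)
              (fun l => by simp only [he]; split_ifs <;> simp) m
      _ = 2 * D := by
          rw [← Finset.mul_sum]
          simpa using hswap (fun _ => 1) fun l => (l : ℝ) + 1
  -- Sample `j` counts towards `K j` of the lower constraints. Subtracting the average `G / n 0`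
  -- makes the weights sum to zero, so the unknown mean disappears from the tilted sum and the upper
  -- constraint at time `n 0` enters with the right sign.
  set u : ℕ → ℝ := fun j => w * (K j - G / n 0) with hu
  have hG1 : G / n 0 ≤ m := by rwa [div_le_iff₀ hn0]
  have hG2 : 0 ≤ G / n 0 := by positivity
  have hub : ∀ j < n 0, |u j| ≤ w * m := by
    intro j _
    rw [hu, abs_mul, abs_of_nonneg hw]
    refine mul_le_mul_of_nonneg_left ?_ hw
    rw [abs_le]
    constructor <;> linarith [hKm j, hK0 j]
  have husq : ∑ j ∈ Finset.range (n 0), u j ^ 2 ≤ w ^ 2 * (2 * D - G ^ 2 / n 0) := by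
    have : ∑ j ∈ Finset.range (n 0), u j ^ 2 =
        w ^ 2 * (∑ j ∈ Finset.range (n 0), K j ^ 2 - G ^ 2 / n 0) := by
      have h1 : ∀ j, u j ^ 2 = w ^ 2 * (K j ^ 2 + (-(2 * (G / n 0))) * K j + (G / n 0) ^ 2) := by
        intro j; simp only [hu]; ring
      simp_rw [h1]
      rw [← Finset.mul_sum, Finset.sum_add_distrib, Finset.sum_add_distrib, ← Finset.mul_sum,
        hKsum]
      simp only [Finset.sum_const, Finset.card_range, nsmul_eq_mul]
      field_simp
      ring
    rw [this]
    gcongr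
  refine (measureReal_mono ?_).trans ((h.chernoff (n 0) u hub
    (a := w * ∑ l ∈ Finset.range m, (x (l + 1) - x 0) * n (l + 1))).trans
    (Real.exp_le_exp.mpr ?_))
  · rintro ω ⟨h1, h2⟩
    simp only [Set.mem_ofPred_eq]
    have e1 : ∑ j ∈ Finset.range (n 0), u j * (X j ω - p) =
        w * (∑ l ∈ Finset.range m, ∑ j ∈ Finset.range (n (l + 1)), X j ω -
          G / n 0 * ∑ j ∈ Finset.range (n 0), X j ω) := by
      have h3 : ∀ j, u j * (X j ω - p) = w * (K j * X j ω - p * K j -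
          G / n 0 * X j ω + G / n 0 * p) := by
        intro j; simp only [hu]; ring
      simp_rw [h3]
      rw [← Finset.mul_sum, Finset.sum_add_distrib, Finset.sum_sub_distrib,
        Finset.sum_sub_distrib, ← Finset.mul_sum, ← Finset.mul_sum, hKsum, hKf]
      simp only [Finset.sum_const, Finset.card_range, nsmul_eq_mul]
      field_simp
      ring
    rw [e1]
    refine mul_le_mul_of_nonneg_left ?_ hw
    have h4 : ∑ l ∈ Finset.range m, x (l + 1) * n (l + 1) ≤
        ∑ l ∈ Finset.range m, ∑ j ∈ Finset.range (n (l + 1)), X j ω :=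
      Finset.sum_le_sum fun l hl => h1 l (Finset.mem_range.mp hl)
    have h5 : G / n 0 * ∑ j ∈ Finset.range (n 0), X j ω ≤ G * x 0 := by
      calc G / n 0 * ∑ j ∈ Finset.range (n 0), X j ω ≤ G / n 0 * (x 0 * n 0) := by gcongr
        _ = G * x 0 := by field_simp
    simp_rw [sub_mul]
    rw [Finset.sum_sub_distrib, ← Finset.mul_sum, ← hG]
    linarith
  · have hp : 0 ≤ p * (1 - p) := by
      obtain ⟨hp0, hp1⟩ := h.mean_mem
      nlinarith
    have hS : 0 ≤ ∑ j ∈ Finset.range (n 0), u j ^ 2 := Finset.sum_nonneg fun j _ => sq_nonneg _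
    have : p * (1 - p) * Real.exp (w * m) * ∑ j ∈ Finset.range (n 0), u j ^ 2 ≤
        v * Real.exp (w * m) * w ^ 2 * (2 * D - G ^ 2 / n 0) := by
      rw [mul_assoc (v * _)]
      exact mul_le_mul (mul_le_mul_of_nonneg_right hv (Real.exp_pos _).le) husq hS
        (mul_nonneg (hp.trans hv) (Real.exp_pos _).le)
    linarith

/-- The bound of `path_bound` with the tilt `δ / σ`, which is optimal when `σ ^ 2` is the variance
and the levels `x l` have slope `σ * δ`. -/
theorem path_bound_of_slope (h : IsBernoulliSeq P X p) {n : ℕ → ℕ} (hn : Antitone n)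
    (h0 : 0 < n 0) {m : ℕ} {x : ℕ → ℝ} {σ δ κ κ' ρ T : ℝ} (hσ : 0 < σ) (hδ : 0 < δ) (hρ : 0 < ρ)
    (hκ : 0 ≤ κ) (hκ1 : κ ≤ 1) (hκ' : κ' ≤ 1)
    (hx : ∀ l < m, ((l : ℝ) + 1) * (σ * δ) * (1 - κ) ≤ x (l + 1) - x 0)
    (hp : p * (1 - p) ≤ (1 + κ) * σ ^ 2) (hm : Real.exp (δ / σ * m) ≤ 1 + κ)
    (hG : n 0 * (1 - κ') / ρ ≤ ∑ l ∈ Finset.range m, (n (l + 1) : ℝ)) (hT : m ≤ T / ρ) :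
    P.real {ω | (∀ l < m, x (l + 1) * n (l + 1) ≤ ∑ j ∈ Finset.range (n (l + 1)), X j ω) ∧
        ∑ j ∈ Finset.range (n 0), X j ω ≤ x 0 * n 0} ≤
      Real.exp (-((δ / ρ) ^ 2 * n 0 * ((1 - κ') ^ 2 / 2 - 4 * κ * T ^ 2))) := by
  have hn0 : (0 : ℝ) < n 0 := by exact_mod_cast h0
  refine (h.path_bound hn h0 m x (w := δ / σ) (by positivity) hp).trans (Real.exp_le_exp.mpr ?_)
  set G : ℝ := ∑ l ∈ Finset.range m, (n (l + 1) : ℝ) with hGdef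
  set D : ℝ := ∑ l ∈ Finset.range m, ((l : ℝ) + 1) * n (l + 1) with hD
  have hle : ∀ l, (n (l + 1) : ℝ) ≤ n 0 := fun l => by exact_mod_cast hn (Nat.zero_le _)
  have hGD : G ^ 2 / n 0 ≤ 2 * D := by
    rw [div_le_iff₀ hn0]
    have := sq_sum_le_two_mul_sum (e := fun l => (n (l + 1) : ℝ)) (c := n 0)
      (fun l => Nat.cast_nonneg _) hle m
    linarith
  have hDm : D ≤ (T / ρ) ^ 2 * n 0 := by
    calc D ≤ ∑ l ∈ Finset.range m, (m : ℝ) * n 0 := by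
          refine Finset.sum_le_sum fun l hl => ?_
          have : (l : ℝ) + 1 ≤ m := by exact_mod_cast Finset.mem_range.mp hl
          exact mul_le_mul this (hle l) (Nat.cast_nonneg _) (Nat.cast_nonneg _)
      _ = (m : ℝ) ^ 2 * n 0 := by simp; ring
      _ ≤ _ := by gcongr
  have hD0 : 0 ≤ D := Finset.sum_nonneg fun l _ => by positivity
  -- For the tilt `δ / σ` and `κ = 0` the gain is `δ² D` and the variance term is `δ² (2 D - G² / n
  -- 0) / 2`. The `D` cancel and `δ² G² / (2 n 0)` remains; the terms with `κ` are errors controlled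
  -- by `hDm`.
  have h1 : δ ^ 2 * (1 - κ) * D ≤
      δ / σ * ∑ l ∈ Finset.range m, (x (l + 1) - x 0) * n (l + 1) := by
    have : σ * δ * (1 - κ) * D ≤ ∑ l ∈ Finset.range m, (x (l + 1) - x 0) * n (l + 1) := by
      rw [hD, Finset.mul_sum]
      refine Finset.sum_le_sum fun l hl => ?_
      have := mul_le_mul_of_nonneg_right (hx l (Finset.mem_range.mp hl))
        (Nat.cast_nonneg (α := ℝ) (n (l + 1)))
      linarith
    calc δ ^ 2 * (1 - κ) * D = δ / σ * (σ * δ * (1 - κ) * D) := by field_simp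
      _ ≤ _ := by gcongr
  have h2 : (1 + κ) * σ ^ 2 * Real.exp (δ / σ * m) * (δ / σ) ^ 2 ≤ (1 + κ) ^ 2 * δ ^ 2 := by
    calc (1 + κ) * σ ^ 2 * Real.exp (δ / σ * m) * (δ / σ) ^ 2
        ≤ (1 + κ) * σ ^ 2 * (1 + κ) * (δ / σ) ^ 2 := by gcongr
      _ = (1 + κ) ^ 2 * δ ^ 2 := by field_simp
  have h3 : n 0 * (1 - κ') ^ 2 / ρ ^ 2 ≤ G ^ 2 / n 0 := by
    have hnn : 0 ≤ n 0 * (1 - κ') / ρ := by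
      have : 0 ≤ 1 - κ' := by linarith
      positivity
    calc n 0 * (1 - κ') ^ 2 / ρ ^ 2 = (n 0 * (1 - κ') / ρ) ^ 2 / n 0 := by field_simp
      _ ≤ _ := by gcongr
  have h4 := mul_le_mul_of_nonneg_right h2 (sub_nonneg.mpr hGD)
  have h5 : (δ / ρ) ^ 2 * n 0 * ((1 - κ') ^ 2 / 2 - 4 * κ * T ^ 2) =
      δ ^ 2 * (n 0 * (1 - κ') ^ 2 / ρ ^ 2 / 2) - 4 * κ * δ ^ 2 * ((T / ρ) ^ 2 * n 0) := by
    field_simp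
  rw [h5]
  have h6 : δ ^ 2 * (n 0 * (1 - κ') ^ 2 / ρ ^ 2) ≤ δ ^ 2 * (G ^ 2 / n 0) := by gcongr
  have h7 : κ * δ ^ 2 * D ≤ κ * δ ^ 2 * ((T / ρ) ^ 2 * n 0) := by gcongr
  have h8 : 0 ≤ κ * δ ^ 2 * (G ^ 2 / n 0) := by positivity
  have h9 : 0 ≤ κ * (1 - κ) * δ ^ 2 * D := by
    have : 0 ≤ 1 - κ := by linarith
    positivity
  have h10 : 0 ≤ κ ^ 2 * δ ^ 2 * (G ^ 2 / n 0) := by positivity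
  linarith

end IsBernoulliSeq

/-! ### The coordinate `θ` -/

theorem hasDerivAt_theta {x : ℝ} (h0 : 0 < x) (h1 : x < 1) :
    HasDerivAt theta (1 / Real.sqrt (x * (1 - x))) x := by
  have h2 : HasDerivAt (fun x : ℝ => 1 - 2 * x) (-2) x := by
    simpa using ((hasDerivAt_id x).const_mul 2).const_sub 1
  have h3 := (Real.hasDerivAt_arccos (x := 1 - 2 * x) (by linarith) (by linarith)).comp x h2
  refine h3.congr_deriv ?_
  have h4 : 1 - (1 - 2 * x) ^ 2 = 2 ^ 2 * (x * (1 - x)) := by ring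
  have h5 : 0 < Real.sqrt (x * (1 - x)) := Real.sqrt_pos.mpr (mul_pos h0 (by linarith))
  rw [h4, Real.sqrt_mul (by norm_num), Real.sqrt_sq (by norm_num)]
  field_simp

theorem integral_one_div_sqrt_eq {a b : ℝ} (ha0 : 0 < a) (ha1 : a < 1) (hb0 : 0 < b)
    (hb1 : b < 1) :
    ∫ x in a..b, 1 / Real.sqrt (x * (1 - x)) = theta b - theta a := by
  have hmem : ∀ x ∈ Set.uIcc a b, 0 < x ∧ x < 1 := fun x hx =>
    ⟨(lt_min ha0 hb0).trans_le hx.1, hx.2.trans_lt (max_lt ha1 hb1)⟩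
  refine intervalIntegral.integral_eq_sub_of_hasDerivAt
    (fun x hx => hasDerivAt_theta (hmem x hx).1 (hmem x hx).2) ?_
  refine ContinuousOn.intervalIntegrable fun x hx => ContinuousAt.continuousWithinAt ?_
  obtain ⟨h0, h1⟩ := hmem x hx
  have h5 : Real.sqrt (x * (1 - x)) ≠ 0 :=
    (Real.sqrt_pos.mpr (mul_pos h0 (by linarith))).ne'
  exact ContinuousAt.div (by fun_prop) (by fun_prop) h5

/-- The inverse of `theta`. -/
noncomputable def thetaInv (t : ℝ) : ℝ := (1 - Real.cos t) / 2

theorem thetaInv_theta {x : ℝ} (h0 : 0 ≤ x) (h1 : x ≤ 1) : thetaInv (theta x) = x := by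
  rw [thetaInv, theta, Real.cos_arccos (by linarith) (by linarith)]
  ring

theorem theta_mem (x : ℝ) : 0 ≤ theta x ∧ theta x ≤ Real.pi :=
  ⟨Real.arccos_nonneg _, Real.arccos_le_pi _⟩

theorem theta_le_iff {x t : ℝ} (h0 : 0 ≤ x) (h1 : x ≤ 1) (ht0 : 0 ≤ t) (ht1 : t ≤ Real.pi) :
    theta x ≤ t ↔ x ≤ thetaInv t := by
  have := Real.strictAntiOn_cos.le_iff_ge (a := t) (b := theta x) ⟨ht0, ht1⟩ (theta_mem x)
  rw [← this, theta, Real.cos_arccos (by linarith) (by linarith), thetaInv]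
  constructor <;> intro h <;> linarith

theorem theta_strictMono {x y : ℝ} (hx : 0 ≤ x) (hxy : x < y) (hy : y ≤ 1) :
    theta x < theta y :=
  Real.strictAntiOn_arccos ⟨by linarith, by linarith⟩ ⟨by linarith, by linarith⟩ (by linarith)

theorem theta_mono {x y : ℝ} (hxy : x ≤ y) : theta x ≤ theta y :=
  Real.antitone_arccos (by linarith)

theorem thetaInv_mono {s t : ℝ} (hs : 0 ≤ s) (hst : s ≤ t) (ht : t ≤ Real.pi) :
    thetaInv s ≤ thetaInv t := by
  have := Real.cos_le_cos_of_nonneg_of_le_pi hs ht hst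
  unfold thetaInv
  linarith

theorem fisherDist_eq {α β : ℝ} (hβ : 0 < β) (hβα : β < α) (hα : α < 1) :
    fisherDist α β = theta α - theta β := by
  have h := theta_strictMono hβ.le hβα hα.le
  rw [fisherDist, integral_one_div_sqrt_eq (hβ.trans hβα) hα hβ (hβα.trans hα),
    abs_of_nonpos (by linarith)]
  ring

theorem rateConst_eq {α β : ℝ} (hβ : 0 < β) (hβα : β < α) (hα : α < 1) :
    rateConst α β = (theta α - theta β) ^ 2 / 2 := by
  rw [rateConst, integral_one_div_sqrt_eq hβ (hβα.trans hα) (hβ.trans hβα) hα]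

/-- Here `sin t / 2` is the standard deviation at the parameter `thetaInv t`; it is also the
derivative of `thetaInv`. Hence equal steps in `θ` are equal numbers of standard deviations. -/
theorem thetaInv_mul_one_sub (t : ℝ) : thetaInv t * (1 - thetaInv t) = (Real.sin t / 2) ^ 2 := by
  have := Real.sin_sq_add_cos_sq t
  unfold thetaInv
  linarith

theorem hasDerivAt_thetaInv (t : ℝ) : HasDerivAt thetaInv (Real.sin t / 2) t := by
  have := ((Real.hasDerivAt_cos t).const_sub 1).div_const 2
  exact this.congr_deriv (by ring)

/-- Second-order Taylor bound: the derivative `sin / 2` of `thetaInv` is `1 / 2`-Lipschitz. -/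
theorem le_thetaInv_add_sub (t : ℝ) {h : ℝ} (hh : 0 ≤ h) :
    Real.sin t / 2 * h - h ^ 2 / 4 ≤ thetaInv (t + h) - thetaInv t := by
  have hd : ∀ s : ℝ, HasDerivAt
      (fun s => thetaInv (t + s) - (Real.sin t / 2 * s - s ^ 2 / 4))
      (Real.sin (t + s) / 2 - (Real.sin t / 2 - s / 2)) s := by
    intro s
    have h1 : HasDerivAt (fun s => thetaInv (t + s)) (Real.sin (t + s) / 2) s :=
      (hasDerivAt_thetaInv (t + s)).comp_const_add t s
    have h2 : HasDerivAt (fun s : ℝ => Real.sin t / 2 * s - s ^ 2 / 4)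
        (Real.sin t / 2 - s / 2) s := by
      have := ((hasDerivAt_id s).const_mul (Real.sin t / 2)).sub ((hasDerivAt_pow 2 s).div_const 4)
      refine this.congr_deriv ?_
      simp; ring
    exact h1.sub h2
  have := monotoneOn_of_hasDerivWithinAt_nonneg (convex_Icc 0 h)
      (fun s _ => (hd s).continuousAt.continuousWithinAt)
      (fun s _ => (hd s).hasDerivWithinAt) (fun s hs => ?_) ⟨le_rfl, hh⟩ ⟨hh, le_rfl⟩ hh
  · simp at this
    linarith
  · rw [interior_Icc] at hs
    have h1 : |Real.sin (t + s) - Real.sin t| ≤ |(t + s) - t| := by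
      have := Real.lipschitzWith_sin.dist_le_mul (t + s) t
      simpa [Real.dist_eq] using this
    rw [add_sub_cancel_left, abs_of_pos hs.1] at h1
    linarith [(abs_le.mp h1).1]

theorem exists_sin_lower_bound {α β : ℝ} (hβ : 0 < β) (hβα : β < α) (hα : α < 1) :
    ∃ s₀ : ℝ, 0 < s₀ ∧ s₀ ≤ 1 ∧ ∀ t ∈ Set.Icc (theta β) (theta α), s₀ ≤ Real.sin t / 2 := by
  have h := theta_strictMono hβ.le hβα hα.le
  obtain ⟨t, ht, hmin⟩ := isCompact_Icc.exists_isMinOn (Set.nonempty_Icc.mpr h.le)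
    (Real.continuous_sin.div_const 2).continuousOn
  refine ⟨Real.sin t / 2, ?_, by linarith [Real.sin_le_one t], fun s hs => hmin hs⟩
  have h0 : 0 < theta β := by
    have := theta_strictMono le_rfl hβ (hβα.trans hα).le
    exact (theta_mem 0).1.trans_lt this
  have h1 : theta α < Real.pi := by
    have := theta_strictMono (hβ.trans hβα).le hα le_rfl
    exact this.trans_le (theta_mem 1).2
  have := Real.sin_pos_of_pos_of_lt_pi (h0.trans_le ht.1) (ht.2.trans_lt h1)
  linarith

theorem mul_sub_le_thetaInv_sub {α β s₀ : ℝ}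
    (hs : ∀ t ∈ Set.Icc (theta β) (theta α), s₀ ≤ Real.sin t / 2) {s t : ℝ}
    (hs1 : theta β ≤ s) (hst : s ≤ t) (ht : t ≤ theta α) :
    s₀ * (t - s) ≤ thetaInv t - thetaInv s := by
  refine (convex_Icc (theta β) (theta α)).mul_sub_le_image_sub_of_le_deriv
    (fun x _ => (hasDerivAt_thetaInv x).continuousAt.continuousWithinAt)
    (fun x _ => (hasDerivAt_thetaInv x).differentiableAt.differentiableWithinAt)
    (fun x hx => ?_) s ⟨hs1, hst.trans ht⟩ t ⟨hs1.trans hst, ht⟩ hst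
  rw [(hasDerivAt_thetaInv x).deriv]
  exact hs x (interior_subset hx)

/-! ### The trajectory of the algorithm -/

/-- The total reward of the first `n` samples of a reward stream. -/
def totalReward (r : ℕ → Bool) (n : ℕ) : ℕ := ∑ j ∈ Finset.range n, (r j).toNat

namespace Params

/-- An arm with reward stream `r` passes all tests up to its `n`-th sample. -/
def Alive (P : Params) (r : ℕ → Bool) (n : ℕ) : Prop :=
  ∀ n', 1 ≤ n' → n' ≤ n → ¬ P.rejects n' (totalReward r n')

open Classical in
/-- The exponential weight `exp (l n)`, where `n ≤ P.N` is the number of samples after which an arm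
with reward stream `r` is rejected. -/
noncomputable def rejectWeight (P : Params) (l : ℝ) (r : ℕ → Bool) : ENNReal :=
  ∑ n ∈ Finset.range P.N, if P.Alive r n ∧ P.rejects (n + 1) (totalReward r (n + 1))
    then ENNReal.ofReal (Real.exp (l * (n + 1 : ℕ))) else 0

open Classical in
/-- The total exponential weight of the sample numbers at which an arm with reward
stream `r` is still under study. -/
noncomputable def aliveWeight (P : Params) (l : ℝ) (r : ℕ → Bool) : ENNReal :=
  ∑ n ∈ Finset.range P.N, if P.Alive r n then ENNReal.ofReal (Real.exp (l * (n + 1 : ℕ))) else 0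

theorem state_append (P : Params) (h : History) (x : ℕ × Bool) :
    P.state (h ++ [x]) = P.step (P.state h) x.2 := by
  simp [state, List.foldl_append]

/-- The state `s` describes the run of the algorithm through the history `h` of length `t`. -/
structure Tracks (P : Params) (l : ℝ) (ω : Env) (t : ℕ) (h : History) (s : ArmState) : Prop where
  arm_le : s.arm ≤ t
  count_le : s.count ≤ t
  countP_eq : h.countP (fun x => x.1 = s.arm) = s.count
  countP_eq_zero : ∀ i, s.arm < i → h.countP (fun x => x.1 = i) = 0
  total_eq : s.total = totalReward (armReward ω s.arm) s.count
  alive : P.Alive (armReward ω s.arm) s.count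
  exp_le : ENNReal.ofReal (Real.exp (l * t)) ≤
    (∏ i ∈ Finset.range s.arm, P.rejectWeight l (armReward ω i)) *
      ENNReal.ofReal (Real.exp (l * s.count))

theorem ofReal_exp_succ (l : ℝ) (n : ℕ) : ENNReal.ofReal (Real.exp (l * (n + 1 : ℕ))) =
    ENNReal.ofReal (Real.exp (l * n)) * ENNReal.ofReal (Real.exp l) := by
  rw [← ENNReal.ofReal_mul (Real.exp_pos _).le, ← Real.exp_add]
  push_cast; ring_nf

/-- A rejection turns the weight of the current arm into the summand of `rejectWeight` with index
`s.count` and resets the count; otherwise only the weight of the current arm grows. That later arms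
are unseen ensures that a new arm starts with its reward number `0`. -/
theorem Tracks.step {P : Params} {l : ℝ} {ω : Env} {t : ℕ} {h : History} {s : ArmState}
    (hs : P.Tracks l ω t h s) (ht : t < P.N) :
    P.Tracks l ω (t + 1) (h ++ [(s.arm, armReward ω s.arm s.count)])
      (P.step s (armReward ω s.arm s.count)) := by
  obtain ⟨h1, h1', h2, h3, h4, h5, h6⟩ := hs
  have htot : s.total + (armReward ω s.arm s.count).toNat =
      totalReward (armReward ω s.arm) (s.count + 1) := by
    rw [h4, totalReward, totalReward, Finset.sum_range_succ]
  by_cases hr : P.rejects (s.count + 1) (totalReward (armReward ω s.arm) (s.count + 1))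
  · have e : P.step s (armReward ω s.arm s.count) = ⟨s.arm + 1, 0, 0⟩ := by
      unfold Params.step
      exact if_pos (by rwa [htot])
    rw [e]
    refine ⟨by simp; omega, by simp, ?_, ?_, by simp [totalReward], ?_, ?_⟩
    · simp only [List.countP_append]
      rw [h3 _ (by simp)]
      simp
    · intro i hi
      simp only at hi
      rw [List.countP_append, h3 i (by omega)]
      simp; omega
    · intro n h7 h8
      simp at h8; omega
    · simp only [Nat.cast_zero, mul_zero, Real.exp_zero, ENNReal.ofReal_one, mul_one]
      rw [Finset.prod_range_succ, ofReal_exp_succ]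
      calc ENNReal.ofReal (Real.exp (l * t)) * ENNReal.ofReal (Real.exp l)
          ≤ ((∏ i ∈ Finset.range s.arm, P.rejectWeight l (armReward ω i)) *
        ENNReal.ofReal (Real.exp (l * s.count))) * ENNReal.ofReal (Real.exp l) := by gcongr
        _ = (∏ i ∈ Finset.range s.arm, P.rejectWeight l (armReward ω i)) *
        ENNReal.ofReal (Real.exp (l * (s.count + 1 : ℕ))) := by rw [ofReal_exp_succ, mul_assoc]
        _ ≤ _ := by
          gcongr
          classical
          have := Finset.single_le_sum
            (f := fun n => if P.Alive (armReward ω s.arm) n ∧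
              P.rejects (n + 1) (totalReward (armReward ω s.arm) (n + 1))
              then ENNReal.ofReal (Real.exp (l * (n + 1 : ℕ))) else 0)
            (fun _ _ => zero_le) (Finset.mem_range.mpr (by omega : s.count < P.N))
          simp only [if_pos (And.intro h5 hr)] at this
          unfold rejectWeight
          convert this
  · have e : P.step s (armReward ω s.arm s.count) =
        ⟨s.arm, s.count + 1, totalReward (armReward ω s.arm) (s.count + 1)⟩ := by
      unfold Params.step
      rw [← htot]
      exact if_neg (by rwa [htot])
    rw [e]
    refine ⟨by simp; omega, by simp; omega, ?_, ?_, rfl, ?_, ?_⟩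
    · simp [List.countP_append, h2]
    · intro i hi
      simp only at hi
      rw [List.countP_append, h3 i (by omega)]
      simp; omega
    · intro n h7 h8
      simp only at h8
      rcases Nat.lt_or_ge s.count n with h9 | h9
      · obtain rfl : n = s.count + 1 := by omega
        exact hr
      · exact h5 n h7 h9
    · simp only
      rw [ofReal_exp_succ, ofReal_exp_succ, ← mul_assoc]
      gcongr

theorem tracks_history (P : Params) (l : ℝ) (ω : Env) (t : ℕ) (ht : t ≤ P.N) :
    P.Tracks l ω t (P.algorithm.history ω t) (P.state (P.algorithm.history ω t)) := by
  induction t with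
  | zero =>
    refine ⟨le_rfl, le_rfl, rfl, fun _ _ => rfl, rfl, fun n h1 h2 => ?_, ?_⟩
    · exact absurd (h1.trans h2) (by simp [BanditAlgorithm.history, state])
    · simp [BanditAlgorithm.history, state]
  | succ t ih =>
    have h := (ih (by omega)).step ht
    have e : P.algorithm.history ω (t + 1) = P.algorithm.history ω t ++
        [((P.state (P.algorithm.history ω t)).arm,
          armReward ω (P.state (P.algorithm.history ω t)).arm
            (P.state (P.algorithm.history ω t)).count)] := by
      rw [← (ih (by omega)).countP_eq]
      rfl
    rw [e, state_append]
    exact h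

theorem exp_le_sum_of_failure (P : Params) (l : ℝ) (ω : Env) (hN : 1 ≤ P.N) (b : ℝ)
    (hω : armMean ω (P.algorithm.result P.N ω) < b) :
    ENNReal.ofReal (Real.exp (l * P.N)) ≤ ∑ I ∈ Finset.range P.N,
      (∏ i ∈ Finset.range I, P.rejectWeight l (armReward ω i)) *
        (P.aliveWeight l (armReward ω I) * (Set.Iio b).indicator 1 (ω.1 I)) := by
  -- The output is the arm of the last sample, hence the arm under study after `N - 1` samples, even
  -- if the last sample gets it rejected. So only survival of `s.count` samples is known, while the
  -- weight counts `s.count + 1`.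
  obtain ⟨t, ht⟩ : ∃ t, P.N = t + 1 := ⟨P.N - 1, by omega⟩
  obtain ⟨h1, h1', h2, h3, h4, h5, h6⟩ := P.tracks_history l ω t (by omega)
  set h := P.algorithm.history ω t with hh
  set s := P.state h with hs
  have hres : P.algorithm.result P.N ω = s.arm := by
    rw [BanditAlgorithm.result, ht, BanditAlgorithm.history]
    simp only [algorithm, List.getLast?_append, List.getLast?_singleton]
    rfl
  rw [hres] at hω
  refine le_trans ?_ (Finset.single_le_sum (fun _ _ => zero_le)
    (Finset.mem_range.mpr (by omega : s.arm < P.N)))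
  have hmem : ω.1 s.arm ∈ Set.Iio b := hω
  rw [Set.indicator_of_mem hmem, Pi.one_apply, mul_one]
  have hal : ENNReal.ofReal (Real.exp (l * (s.count + 1 : ℕ))) ≤
      P.aliveWeight l (armReward ω s.arm) := by
    classical
    have := Finset.single_le_sum
      (f := fun n => if P.Alive (armReward ω s.arm) n
        then ENNReal.ofReal (Real.exp (l * (n + 1 : ℕ))) else 0)
      (fun _ _ => zero_le) (Finset.mem_range.mpr (by omega : s.count < P.N))
    simp only [if_pos h5] at this
    unfold aliveWeight
    convert this
  calc ENNReal.ofReal (Real.exp (l * P.N))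
      = ENNReal.ofReal (Real.exp (l * t)) * ENNReal.ofReal (Real.exp l) := by rw [ht, ofReal_exp_succ]
    _ ≤ ((∏ i ∈ Finset.range s.arm, P.rejectWeight l (armReward ω i)) *
          ENNReal.ofReal (Real.exp (l * s.count))) * ENNReal.ofReal (Real.exp l) := by gcongr
    _ = (∏ i ∈ Finset.range s.arm, P.rejectWeight l (armReward ω i)) *
          ENNReal.ofReal (Real.exp (l * (s.count + 1 : ℕ))) := by rw [ofReal_exp_succ, mul_assoc]
    _ ≤ _ := by gcongr

end Params

/-! ### Independence of the arms -/

/-- The law of the reward seeds of a single arm. -/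
noncomputable def seedLaw : Measure (ℕ → unitInterval) :=
  Measure.infinitePi fun _ : ℕ => (volume : Measure unitInterval)

instance : IsProbabilityMeasure seedLaw := by unfold seedLaw; infer_instance

open Classical in
/-- The reward stream of an arm of mean `p` with seeds `v`. -/
noncomputable def rewardStream (x : ℝ × (ℕ → unitInterval)) (n : ℕ) : Bool :=
  decide ((x.2 n : ℝ) < x.1)

theorem measurable_rewardStream : Measurable rewardStream := by
  refine measurable_pi_lambda _ fun n => measurable_to_bool ?_
  have : (fun x => rewardStream x n) ⁻¹' {true} =
      {x : ℝ × (ℕ → unitInterval) | (x.2 n : ℝ) < x.1} := by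
    ext x; simp [rewardStream]
  rw [this]
  exact measurableSet_lt (by fun_prop) (by fun_prop)

theorem measurable_totalReward (n : ℕ) : Measurable fun r : ℕ → Bool => totalReward r n := by
  unfold totalReward
  exact Finset.measurable_sum _ fun j _ =>
    (measurable_of_countable Bool.toNat).comp (measurable_pi_apply j)

theorem lintegral_envLaw_prod (μ : Measure ℝ) [IsProbabilityMeasure μ]
    {F : ℕ → ℝ × (ℕ → unitInterval) → ENNReal} (hF : ∀ i, Measurable (F i)) (s : Finset ℕ) :
    ∫⁻ ω, ∏ i ∈ s, F i (ω.1 i, fun n => ω.2 (i, n)) ∂envLaw μ =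
      ∏ i ∈ s, ∫⁻ p, ∫⁻ v, F i (p, v) ∂seedLaw ∂μ := by
  have hm : Measurable fun ω : Env => ∏ i ∈ s, F i (ω.1 i, fun n => ω.2 (i, n)) :=
    Finset.measurable_prod _ fun i _ => (hF i).comp (by fun_prop)
  rw [envLaw, lintegral_prod _ hm.aemeasurable]
  have hinner : ∀ q : ℕ → ℝ,
      ∫⁻ u, ∏ i ∈ s, F i (q i, fun n => u (i, n))
        ∂(Measure.infinitePi fun _ : ℕ × ℕ => (volume : Measure unitInterval)) =
      ∏ i ∈ s, ∫⁻ v, F i (q i, v) ∂seedLaw := by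
    intro q
    have hFq : ∀ i, Measurable fun v => F i (q i, v) := fun i => (hF i).comp (by fun_prop)
    have hm2 : Measurable fun v : ℕ → ℕ → unitInterval => ∏ i ∈ s, F i (q i, v i) :=
      Finset.measurable_prod _ fun i _ => (hFq i).comp (measurable_pi_apply i)
    -- Currying groups the seeds by arm, which makes the seed sequences of the arms independent with
    -- law `seedLaw`.
    have hc := Measure.infinitePi_map_curry
      (fun (_ : ℕ) (_ : ℕ) => (volume : Measure unitInterval))
    have e1 : ∫⁻ u, ∏ i ∈ s, F i (q i, fun n => u (i, n))
        ∂(Measure.infinitePi fun _ : ℕ × ℕ => (volume : Measure unitInterval)) =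
        ∫⁻ v, ∏ i ∈ s, F i (q i, v i) ∂(Measure.infinitePi fun _ : ℕ => seedLaw) := by
      unfold seedLaw
      rw [← hc, lintegral_map hm2 (MeasurableEquiv.measurable _)]
      rfl
    rw [e1, lintegral_prod_eq_prod_lintegral_of_indepFun s
      (fun i (v : ℕ → ℕ → unitInterval) => F i (q i, v i))
      (iIndepFun_infinitePi hFq) fun i => (hFq i).comp (measurable_pi_apply i)]
    refine Finset.prod_congr rfl fun i _ => ?_
    rw [← lintegral_map (f := fun v => F i (q i, v)) (hFq i) (measurable_pi_apply i),
      Measure.infinitePi_map_eval]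
  simp_rw [hinner]
  have hG : ∀ i, Measurable fun p => ∫⁻ v, F i (p, v) ∂seedLaw := fun i =>
    (hF i).lintegral_prod_right'
  rw [lintegral_prod_eq_prod_lintegral_of_indepFun s
    (fun i (q : ℕ → ℝ) => ∫⁻ v, F i (q i, v) ∂seedLaw)
    (iIndepFun_infinitePi hG) fun i => (hG i).comp (measurable_pi_apply i)]
  refine Finset.prod_congr rfl fun i _ => ?_
  rw [← lintegral_map (f := fun p => ∫⁻ v, F i (p, v) ∂seedLaw) (hG i) (measurable_pi_apply i),
    Measure.infinitePi_map_eval]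

theorem isBernoulliSeq_rewardStream {p : ℝ} (h0 : 0 ≤ p) (h1 : p ≤ 1) :
    IsBernoulliSeq seedLaw (fun n v => ((rewardStream (p, v) n).toNat : ℝ)) p := by
  have hg : Measurable fun y : unitInterval => Set.indicator {y : unitInterval | (y : ℝ) < p}
      (1 : unitInterval → ℝ) y :=
    measurable_one.indicator (measurableSet_lt (by fun_prop) (by fun_prop))
  have e : (fun n v => ((rewardStream (p, v) n).toNat : ℝ)) =
      fun n (v : ℕ → unitInterval) => Set.indicator {y : unitInterval | (y : ℝ) < p}
      (1 : unitInterval → ℝ) (v n) := by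
    ext n v
    by_cases h : (v n : ℝ) < p <;> simp [rewardStream, h]
  rw [e]
  refine ⟨fun n => hg.comp (measurable_pi_apply n), ?_, fun n v => ?_, fun n => ?_⟩
  · exact iIndepFun_infinitePi fun _ => hg
  · by_cases h : (v n : ℝ) < p <;> simp [h]
  · have := integral_map (μ := seedLaw) (measurable_pi_apply n).aemeasurable
      (f := fun y : unitInterval => Set.indicator {y : unitInterval | (y : ℝ) < p}
        (1 : unitInterval → ℝ) y) hg.aestronglyMeasurable
    rw [← this, seedLaw, Measure.infinitePi_map_eval,
      integral_indicator_one (measurableSet_lt (by fun_prop) (by fun_prop))]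
    have : {y : unitInterval | (y : ℝ) < p} = Set.Iio ⟨p, h0, h1⟩ := rfl
    rw [this, measureReal_def, unitInterval.volume_Iio]
    simp [h0]

namespace Params

theorem measurableSet_rejects (P : Params) (n : ℕ) :
    MeasurableSet {r : ℕ → Bool | P.rejects n (totalReward r n)} :=
  measurable_totalReward n (MeasurableSet.of_discrete (s := {R : ℕ | P.rejects n R}))

theorem measurableSet_alive (P : Params) (n : ℕ) :
    MeasurableSet {r : ℕ → Bool | P.Alive r n} := by
  have : {r : ℕ → Bool | P.Alive r n} =
      ⋂ n', ⋂ (_ : 1 ≤ n'), ⋂ (_ : n' ≤ n), {r : ℕ → Bool | P.rejects n' (totalReward r n')}ᶜ := by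
    ext r; simp [Alive]
  rw [this]
  exact .iInter fun n' => .iInter fun _ => .iInter fun _ => (P.measurableSet_rejects n').compl

theorem measurable_rejectWeight (P : Params) (l : ℝ) : Measurable (P.rejectWeight l) := by
  unfold rejectWeight
  exact Finset.measurable_sum _ fun n _ => Measurable.ite
    ((P.measurableSet_alive n).inter (P.measurableSet_rejects (n + 1)))
    measurable_const measurable_const

theorem measurable_aliveWeight (P : Params) (l : ℝ) : Measurable (P.aliveWeight l) := by
  unfold aliveWeight
  exact Finset.measurable_sum _ fun n _ => Measurable.ite
    (P.measurableSet_alive n) measurable_const measurable_const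

theorem exp_mul_failureProb_le (P : Params) (l : ℝ) (hN : 1 ≤ P.N) (b : ℝ) (μ : Measure ℝ)
    [IsProbabilityMeasure μ] :
    ENNReal.ofReal (Real.exp (l * P.N)) * P.algorithm.failureProb P.N μ b ≤
      ∑ I ∈ Finset.range P.N,
        (∫⁻ p, ∫⁻ v, P.rejectWeight l (rewardStream (p, v)) ∂seedLaw ∂μ) ^ I *
        ∫⁻ p, ∫⁻ v, P.aliveWeight l (rewardStream (p, v)) * (Set.Iio b).indicator 1 p
          ∂seedLaw ∂μ := by
  set W : ℝ × (ℕ → unitInterval) → ENNReal := fun x => P.rejectWeight l (rewardStream x) with hW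
  set Z : ℝ × (ℕ → unitInterval) → ENNReal := fun x =>
    P.aliveWeight l (rewardStream x) * (Set.Iio b).indicator 1 x.1 with hZ
  have hWm : Measurable W := (P.measurable_rejectWeight l).comp measurable_rewardStream
  have hZm : Measurable Z := ((P.measurable_aliveWeight l).comp measurable_rewardStream).mul
    ((measurable_one.indicator measurableSet_Iio).comp measurable_fst)
  have hterm : ∀ I : ℕ, ∀ ω : Env,
      (∏ i ∈ Finset.range I, P.rejectWeight l (armReward ω i)) *
        (P.aliveWeight l (armReward ω I) * (Set.Iio b).indicator 1 (ω.1 I)) =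
      ∏ i ∈ Finset.range (I + 1), (if i = I then Z else W) (ω.1 i, fun n => ω.2 (i, n)) := by
    intro I ω
    rw [Finset.prod_range_succ, if_pos rfl]
    congr 1
    refine Finset.prod_congr rfl fun i hi => ?_
    rw [if_neg (Finset.mem_range.mp hi).ne]
    rfl
  have hFm : ∀ I i : ℕ, Measurable (if i = I then Z else W) := by
    intro I i; split_ifs <;> assumption
  calc ENNReal.ofReal (Real.exp (l * P.N)) * P.algorithm.failureProb P.N μ b
      ≤ ENNReal.ofReal (Real.exp (l * P.N)) * envLaw μ {ω | ENNReal.ofReal (Real.exp (l * P.N)) ≤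
          ∑ I ∈ Finset.range P.N, ∏ i ∈ Finset.range (I + 1),
            (if i = I then Z else W) (ω.1 i, fun n => ω.2 (i, n))} := by
        -- Monotonicity passes to a superlevel set of the weight, ready for Markov's inequality; no
        -- measurability of the failure event is needed.
        refine mul_le_mul_right (measure_mono fun ω hω => ?_) _
        have := P.exp_le_sum_of_failure l ω hN b hω
        simp_rw [hterm] at this
        exact this
    _ ≤ ∫⁻ ω, ∑ I ∈ Finset.range P.N, ∏ i ∈ Finset.range (I + 1),
            (if i = I then Z else W) (ω.1 i, fun n => ω.2 (i, n)) ∂envLaw μ := by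
        refine mul_meas_ge_le_lintegral ?_ _
        exact Finset.measurable_sum _ fun I _ => Finset.measurable_prod _ fun i _ =>
          (hFm I i).comp (by fun_prop)
    _ = ∑ I ∈ Finset.range P.N, ∏ i ∈ Finset.range (I + 1),
          ∫⁻ p, ∫⁻ v, (if i = I then Z else W) (p, v) ∂seedLaw ∂μ := by
        have hm : ∀ I ∈ Finset.range P.N, Measurable fun ω : Env =>
            ∏ i ∈ Finset.range (I + 1), (if i = I then Z else W) (ω.1 i, fun n => ω.2 (i, n)) :=
          fun I _ => Finset.measurable_prod _ fun i _ => (hFm I i).comp (by fun_prop)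
        rw [lintegral_finsetSum _ hm]
        exact Finset.sum_congr rfl fun I _ => lintegral_envLaw_prod μ (hFm I) _
    _ = _ := by
        refine Finset.sum_congr rfl fun I _ => ?_
        rw [Finset.prod_range_succ, if_pos rfl]
        congr 1
        rw [Finset.prod_congr rfl (g := fun _ => ∫⁻ p, ∫⁻ v, W (p, v) ∂seedLaw ∂μ)
          fun i hi => by rw [if_neg (Finset.mem_range.mp hi).ne],
          Finset.prod_const, Finset.card_range]

end Params

/-! ### Checkpoints and thresholds -/

namespace Params

/-- The decrease of the threshold between two late checkpoints, in the coordinate `theta`. -/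
noncomputable def slope (P : Params) : ℝ :=
  fisherDist P.α P.β * P.ϱ * (1 - P.ϱ₂) / Real.log P.N

/-- The threshold at a late checkpoint in the coordinate `theta`. -/
noncomputable def angle (P : Params) (k : ℕ) : ℝ :=
  theta (P.α - 2 * P.ϱ) - ((k - P.k₀ : ℕ) : ℝ) * P.slope

/-- The rejection threshold for the empirical average at the `k`-th checkpoint. -/
noncomputable def threshold (P : Params) (k : ℕ) : ℝ :=
  if k ≤ P.k₀ then P.α - P.ϱ - k / Real.sqrt (Real.log P.N) else thetaInv (P.angle k)

/-- Numerical conditions on the parameters under which the sharp rejection bounds hold. -/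
structure Regular (P : Params) (s₀ T κ c ε : ℝ) : Prop where
  β_pos : 0 < P.β
  β_lt_α : P.β < P.α
  α_lt_one : P.α < 1
  s₀_pos : 0 < s₀
  s₀_le_one : s₀ ≤ 1
  s₀_le_sin : ∀ t ∈ Set.Icc (theta P.β) (theta P.α), s₀ ≤ Real.sin t / 2
  one_le_T : 1 ≤ T
  κ_pos : 0 < κ
  κ_le_one : κ ≤ 1
  c_nonneg : 0 ≤ c
  ε_pos : 0 < ε
  ϱ_pos : 0 < P.ϱ
  ϱ_le_one : P.ϱ ≤ 1
  ϱ₂_pos : 0 < P.ϱ₂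
  ϱ₂_lt_one : P.ϱ₂ < 1
  one_le_log : 1 ≤ Real.log P.N
  one_le_b₀_mul : 1 ≤ P.b₀ * P.ϱ
  k₀_div_le : P.k₀ / Real.sqrt (Real.log P.N) ≤ P.ϱ / 2
  four_ϱ_le : 4 * P.ϱ ≤ P.α - P.β
  angle_gap : (theta P.α - theta P.β) * (1 - P.ϱ₂) * (1 + P.ϱ) + 2 * P.ϱ / s₀ +
    (theta P.α - theta P.β) * P.ϱ₂ / 2 ≤ theta P.α - theta P.β
  early_rate : 3 * c / Real.log P.N ^ 2 ≤ 1 / (16 * Real.log P.N)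
  middle_rate : 2 * Real.exp (T + 1) * c / Real.log P.N ^ 2 ≤ P.ϱ ^ 2 / 64
  middle_small : 2 * Real.log P.N ≤ Real.log P.N ^ 4 * P.ϱ ^ 2 / 64
  tilt_small : (T + 1) * ((theta P.α - theta P.β) / Real.log P.N) ≤ κ * s₀ / 2
  far_rate : (c + ε) / Real.log P.N ^ 2 ≤ (κ * s₀ ^ 2) ^ 2 / 6
  near_rate : c + ε ≤ (theta P.α - theta P.β) ^ 2 * (1 - P.ϱ₂) ^ 2 *
    ((1 - 2 / (1 + T)) ^ 2 / 2 - 4 * κ * (T + 1) ^ 2)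
  late_small : 2 * Real.log P.N ≤ ε * Real.log P.N ^ 2
  T_le : 1 + T ≤ Real.log P.N ^ 4
  alive_early : 3 * c / Real.log P.N ^ 2 ≤ ((P.α - P.β) / 2) ^ 2 / 2
  alive_late : 3 * c / Real.log P.N ^ 2 ≤
    (s₀ * ((theta P.α - theta P.β) * P.ϱ₂ / 2)) ^ 2 / 2

namespace Regular

variable {P : Params} {s₀ T κ c ε : ℝ}

theorem fisherDist_eq (h : P.Regular s₀ T κ c ε) :
    fisherDist P.α P.β = theta P.α - theta P.β :=
  _root_.fisherDist_eq h.β_pos h.β_lt_α h.α_lt_one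

theorem T_pos (h : P.Regular s₀ T κ c ε) : 0 < T := by linarith [h.one_le_T]

theorem dist_pos (h : P.Regular s₀ T κ c ε) : 0 < theta P.α - theta P.β :=
  sub_pos.mpr (theta_strictMono h.β_pos.le h.β_lt_α h.α_lt_one.le)

theorem b₀_pos (h : P.Regular s₀ T κ c ε) : 0 < P.b₀ := by
  rcases Nat.eq_zero_or_pos P.b₀ with h0 | h0
  · have := h.one_le_b₀_mul
    rw [h0] at this
    norm_num at this
  · exact h0

theorem le_b (P : Params) (k : ℕ) : P.b₀ * (1 + P.ϱ) ^ k ≤ P.b k := Nat.le_ceil _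

theorem b_lt (h : P.Regular s₀ T κ c ε) (k : ℕ) : P.b k < P.b₀ * (1 + P.ϱ) ^ k + 1 := by
  refine Nat.ceil_lt_add_one ?_
  have := h.ϱ_pos
  positivity

theorem one_le_pow (h : P.Regular s₀ T κ c ε) (k : ℕ) : 1 ≤ (1 + P.ϱ) ^ k :=
  one_le_pow₀ (by linarith [h.ϱ_pos])

theorem one_le_real (h : P.Regular s₀ T κ c ε) (k : ℕ) : 1 ≤ P.b₀ * (1 + P.ϱ) ^ k :=
  one_le_mul_of_one_le_of_one_le (by exact_mod_cast h.b₀_pos) (h.one_le_pow k)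

/-- Before rounding, consecutive values differ by at least `b₀ ϱ ≥ 1`, so rounding up keeps them
distinct. A sample number then determines its checkpoint. -/
theorem b_strictMono (h : P.Regular s₀ T κ c ε) : StrictMono P.b := by
  refine strictMono_nat_of_lt_succ fun k => ?_
  have h1 := h.b_lt k
  have h2 := le_b P (k + 1)
  have h3 : P.b₀ * (1 + P.ϱ) ^ k + 1 ≤ P.b₀ * (1 + P.ϱ) ^ (k + 1) := by
    rw [pow_succ]
    nlinarith [h.one_le_pow k, h.one_le_b₀_mul]
  exact_mod_cast h1.trans_le (h3.trans h2)

theorem b_zero (P : Params) : P.b 0 = P.b₀ := by simp [Params.b]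

theorem b_succ_le (h : P.Regular s₀ T κ c ε) (k : ℕ) : (P.b (k + 1) : ℝ) ≤ 3 * P.b k := by
  have h1 := (h.b_lt (k + 1)).le
  have h2 := le_b P k
  have h3 := h.one_le_real k
  rw [pow_succ] at h1
  nlinarith [h.ϱ_le_one]

theorem log_pow_le_b (h : P.Regular s₀ T κ c ε) {k : ℕ} (hk : P.k₀ ≤ k) :
    Real.log P.N ^ 4 ≤ P.b k := by
  have hb : (0 : ℝ) < P.b₀ := by exact_mod_cast h.b₀_pos
  have hL := h.one_le_log
  have h1 : Real.logb (1 + P.ϱ) (Real.log P.N ^ 4 / P.b₀) ≤ (P.k₀ : ℝ) := Nat.le_ceil _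
  rw [Real.logb_le_iff_le_rpow (by linarith [h.ϱ_pos]) (by positivity), Real.rpow_natCast,
    div_le_iff₀ hb] at h1
  have h2 : (P.b P.k₀ : ℝ) ≤ P.b k := by exact_mod_cast h.b_strictMono.monotone hk
  have h3 := le_b P P.k₀
  linarith

theorem exp_log (h : P.Regular s₀ T κ c ε) : Real.exp (Real.log P.N) = P.N := by
  refine Real.exp_log ?_
  have h1 := h.one_le_log
  rcases Nat.eq_zero_or_pos P.N with h0 | h0
  · rw [h0] at h1; norm_num at h1
  · exact_mod_cast h0

theorem slope_eq (h : P.Regular s₀ T κ c ε) :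
    P.slope = (theta P.α - theta P.β) * P.ϱ * (1 - P.ϱ₂) / Real.log P.N := by
  rw [slope, h.fisherDist_eq]

theorem slope_pos (h : P.Regular s₀ T κ c ε) : 0 < P.slope := by
  rw [h.slope_eq]
  have := h.one_le_log
  have := h.dist_pos
  have := h.ϱ_pos
  have : 0 < 1 - P.ϱ₂ := by linarith [h.ϱ₂_lt_one]
  positivity

/-- From `(1 + ϱ)^k ≤ N` and `log (1 + ϱ) ≥ ϱ / (1 + ϱ)`: about `log N / ϱ` checkpoints fit into the
budget, which is what the slope is calibrated to. -/
theorem index_mul_le (h : P.Regular s₀ T κ c ε) {k : ℕ} (hN : P.b k ≤ P.N) :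
    k * P.ϱ ≤ Real.log P.N * (1 + P.ϱ) := by
  have h1 : (1 + P.ϱ) ^ k ≤ P.N := by
    calc (1 + P.ϱ) ^ k ≤ P.b₀ * (1 + P.ϱ) ^ k := by
          refine le_mul_of_one_le_left (by linarith [h.one_le_pow k]) ?_
          exact_mod_cast h.b₀_pos
      _ ≤ P.b k := le_b P k
      _ ≤ P.N := by exact_mod_cast hN
  have hϱ := h.ϱ_pos
  have h2 := Real.log_le_log (by positivity) h1
  rw [Real.log_pow] at h2
  have h3 := Real.one_sub_inv_le_log_of_pos (show 0 < 1 + P.ϱ by linarith)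
  have h4 : P.ϱ / (1 + P.ϱ) ≤ Real.log (1 + P.ϱ) := by
    refine le_trans (le_of_eq ?_) h3
    field_simp; ring
  have h5 : k * (P.ϱ / (1 + P.ϱ)) ≤ Real.log P.N :=
    (mul_le_mul_of_nonneg_left h4 (Nat.cast_nonneg k)).trans h2
  rw [← mul_div_assoc, div_le_iff₀ (by linarith)] at h5
  exact h5

theorem angle_le (h : P.Regular s₀ T κ c ε) (k : ℕ) : P.angle k ≤ theta (P.α - 2 * P.ϱ) := by
  have := h.slope_pos
  unfold angle
  have : 0 ≤ ((k - P.k₀ : ℕ) : ℝ) * P.slope := by positivity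
  linarith

theorem theta_sub_le (h : P.Regular s₀ T κ c ε) : theta (P.α - 2 * P.ϱ) ≤ theta P.α :=
  theta_mono (by linarith [h.ϱ_pos])

theorem theta_β_le (h : P.Regular s₀ T κ c ε) : theta P.β ≤ theta (P.α - 2 * P.ϱ) :=
  theta_mono (by linarith [h.four_ϱ_le, h.ϱ_pos])

/-- All late decreases together use at most `d (1 - ϱ₂) (1 + ϱ)` of the distance `d` from `θ(α)` to
`θ(β)`, and starting at `α - 2ϱ` loses at most `2ϱ / s₀`. The slack `d ϱ₂` pays for this with half
of it to spare. -/
theorem le_angle (h : P.Regular s₀ T κ c ε) {k : ℕ} (hN : P.b k ≤ P.N) :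
    theta P.β + (theta P.α - theta P.β) * P.ϱ₂ / 2 ≤ P.angle k := by
  have hd := h.dist_pos
  have hϱ := h.ϱ_pos
  have hL := h.one_le_log
  have h2 : 0 < 1 - P.ϱ₂ := by linarith [h.ϱ₂_lt_one]
  have h1 := mul_sub_le_thetaInv_sub h.s₀_le_sin h.theta_β_le h.theta_sub_le le_rfl
  rw [thetaInv_theta (by linarith [h.β_pos, h.β_lt_α]) h.α_lt_one.le,
    thetaInv_theta (by linarith [h.β_pos, h.four_ϱ_le]) (by linarith [h.α_lt_one])] at h1
  have h3 : theta P.α - theta (P.α - 2 * P.ϱ) ≤ 2 * P.ϱ / s₀ := by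
    rw [le_div_iff₀ h.s₀_pos]
    linarith
  have h4 : ((k - P.k₀ : ℕ) : ℝ) * P.slope ≤
      (theta P.α - theta P.β) * (1 - P.ϱ₂) * (1 + P.ϱ) := by
    have h5 : ((k - P.k₀ : ℕ) : ℝ) ≤ k := by exact_mod_cast Nat.sub_le _ _
    calc ((k - P.k₀ : ℕ) : ℝ) * P.slope ≤ k * P.slope :=
          mul_le_mul_of_nonneg_right h5 h.slope_pos.le
      _ = (theta P.α - theta P.β) * (1 - P.ϱ₂) / Real.log P.N * (k * P.ϱ) := by
          rw [h.slope_eq]; ring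
      _ ≤ (theta P.α - theta P.β) * (1 - P.ϱ₂) / Real.log P.N *
            (Real.log P.N * (1 + P.ϱ)) :=
          mul_le_mul_of_nonneg_left (h.index_mul_le hN) (by positivity)
      _ = _ := by field_simp
  unfold angle
  linarith [h.angle_gap]

theorem angle_mem (h : P.Regular s₀ T κ c ε) {k : ℕ} (hN : P.b k ≤ P.N) :
    P.angle k ∈ Set.Icc (theta P.β) (theta P.α) := by
  have h1 := h.le_angle hN
  have h2 : 0 ≤ (theta P.α - theta P.β) * P.ϱ₂ / 2 := by
    have := h.dist_pos
    have := h.ϱ₂_pos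
    positivity
  exact ⟨by linarith, (h.angle_le k).trans h.theta_sub_le⟩

/-- The restriction to checkpoints within the budget keeps the angle in `[0, π]`, where the test in
`θ` can be inverted. -/
theorem rejectTest_iff (h : P.Regular s₀ T κ c ε) {k : ℕ} (hN : P.b k ≤ P.N) {x : ℝ}
    (hx0 : 0 ≤ x) (hx1 : x ≤ 1) : P.rejectTest k x ↔ x ≤ P.threshold k := by
  have hm := h.angle_mem hN
  unfold rejectTest threshold
  split_ifs with hk
  · constructor
    · rintro (⟨_, h1⟩ | ⟨j, hj, hj', _⟩)
      · exact h1
      · omega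
    · exact fun h1 => Or.inl ⟨hk, h1⟩
  · rw [← theta_le_iff hx0 hx1 ((theta_mem _).1.trans hm.1) (hm.2.trans (theta_mem _).2)]
    constructor
    · rintro (⟨h1, _⟩ | ⟨j, hj, hj', h1⟩)
      · omega
      · rw [angle, slope, hj', Nat.add_sub_cancel_left]
        exact h1
    · exact fun h1 => Or.inr ⟨k - P.k₀, by omega, by omega, h1⟩

theorem threshold_of_le {k : ℕ} (hk : k ≤ P.k₀) :
    P.threshold k = P.α - P.ϱ - k / Real.sqrt (Real.log P.N) := if_pos hk

theorem threshold_of_lt {k : ℕ} (hk : P.k₀ < k) : P.threshold k = thetaInv (P.angle k) :=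
  if_neg (by omega)

theorem le_threshold_of_le (h : P.Regular s₀ T κ c ε) {k : ℕ} (hk : k ≤ P.k₀) :
    P.α - 3 / 2 * P.ϱ ≤ P.threshold k := by
  rw [threshold_of_le hk]
  have h1 := h.k₀_div_le
  have h2 : k / Real.sqrt (Real.log P.N) ≤ P.k₀ / Real.sqrt (Real.log P.N) := by gcongr
  linarith

theorem threshold_le_of_lt (h : P.Regular s₀ T κ c ε) {k : ℕ} (hk : P.k₀ < k)
    (hN : P.b k ≤ P.N) : P.threshold k ≤ P.α - 2 * P.ϱ := by
  rw [threshold_of_lt hk]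
  refine (thetaInv_mono ((theta_mem _).1.trans (h.angle_mem hN).1) (h.angle_le k)
    (theta_mem _).2).trans (le_of_eq ?_)
  exact thetaInv_theta (by linarith [h.β_pos, h.four_ϱ_le, h.ϱ_pos])
    (by linarith [h.α_lt_one, h.ϱ_pos])

theorem β_add_le_threshold (h : P.Regular s₀ T κ c ε) {k : ℕ} (hk : P.k₀ < k)
    (hN : P.b k ≤ P.N) :
    P.β + s₀ * ((theta P.α - theta P.β) * P.ϱ₂ / 2) ≤ P.threshold k := by
  rw [threshold_of_lt hk]
  have h1 := mul_sub_le_thetaInv_sub h.s₀_le_sin le_rfl (h.angle_mem hN).1 (h.angle_mem hN).2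
  rw [thetaInv_theta h.β_pos.le (by linarith [h.β_lt_α, h.α_lt_one])] at h1
  have h2 := mul_le_mul_of_nonneg_left (h.le_angle hN) h.s₀_pos.le
  linarith

end Regular

end Params

/-! ### Rejection probabilities of a single arm -/

namespace Params

/-- The event that the first rejecting test is the one at the `k`-th checkpoint. -/
def rejectEvent {Ω : Type*} (P : Params) (X : ℕ → Ω → ℝ) (k : ℕ) : Set Ω :=
  {ω | (∀ k' < k, P.threshold k' * P.b k' ≤ ∑ j ∈ Finset.range (P.b k'), X j ω) ∧
    ∑ j ∈ Finset.range (P.b k), X j ω ≤ P.threshold k * P.b k}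

namespace Regular

variable {P : Params} {s₀ T κ c ε : ℝ} {Ω : Type*} [MeasurableSpace Ω] {Q : Measure Ω}
  [IsProbabilityMeasure Q] {X : ℕ → Ω → ℝ} {p : ℝ}

/-- The first test has no predecessor to compare with, so this is the only rejection bound that
needs a good mean. -/
theorem rejectEvent_zero_le (h : P.Regular s₀ T κ c ε) (hX : IsBernoulliSeq Q X p)
    (hp : P.α ≤ p) : Q.real (P.rejectEvent X 0) ≤ Real.exp (-(P.b₀ * P.ϱ ^ 2 / 2)) := by
  have h1 := hX.lower_tail (P.b 0) (x := P.threshold 0) (a := P.ϱ) h.ϱ_pos.le h.ϱ_le_one (by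
    rw [threshold_of_le (Nat.zero_le _)]
    simp
    linarith)
  rw [b_zero] at h1
  refine (measureReal_mono fun ω hω => ?_).trans h1
  have := hω.2
  rwa [b_zero] at this

/-- Consecutive early thresholds differ by `1 / √(log N)`, so passing one test and failing the next
costs `b_k / (8 log N)`. Half of it pays for the weight, which is only of order `b_k / log² N`. -/
theorem rejectEvent_early_le (h : P.Regular s₀ T κ c ε) (hX : IsBernoulliSeq Q X p) {k : ℕ}
    (hk : k + 1 ≤ P.k₀) :
    Real.exp (c / Real.log P.N ^ 2 * P.b (k + 1)) * Q.real (P.rejectEvent X (k + 1)) ≤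
      Real.exp (-(P.b₀ / (16 * Real.log P.N))) := by
  have hL := h.one_le_log
  have hs : 0 < Real.sqrt (Real.log P.N) := Real.sqrt_pos.mpr (by linarith)
  have hs1 : 1 ≤ Real.sqrt (Real.log P.N) := Real.one_le_sqrt.mpr hL
  have hgap : P.threshold k - P.threshold (k + 1) = 1 / Real.sqrt (Real.log P.N) := by
    rw [threshold_of_le hk, threshold_of_le (by omega)]
    push_cast
    field_simp
    ring
  have hgap0 : 0 < 1 / Real.sqrt (Real.log P.N) := by positivity
  have hgap1 : 1 / Real.sqrt (Real.log P.N) ≤ 1 := by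
    rw [div_le_one hs]; exact hs1
  have h1 := hX.two_point (h.b_strictMono.monotone (Nat.le_succ k))
    (x₁ := P.threshold k) (x₂ := P.threshold (k + 1)) (by linarith) (by linarith)
  have h2 : Q.real (P.rejectEvent X (k + 1)) ≤
      Real.exp (-(P.b k * (1 / Real.sqrt (Real.log P.N)) ^ 2 / 8)) := by
    rw [← hgap]
    refine le_trans (measureReal_mono fun ω hω => ?_) h1
    exact ⟨hω.1 k (Nat.lt_succ_self k), hω.2⟩
  have h3 : (P.b₀ : ℝ) ≤ P.b k := by
    rw [← b_zero]; exact_mod_cast h.b_strictMono.monotone (Nat.zero_le k)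
  have h4 : (1 / Real.sqrt (Real.log P.N)) ^ 2 = 1 / Real.log P.N := by
    rw [div_pow, Real.sq_sqrt (by linarith), one_pow]
  rw [h4] at h2
  refine (mul_le_mul_of_nonneg_left h2 (Real.exp_pos _).le).trans ?_
  rw [← Real.exp_add]
  refine Real.exp_le_exp.mpr ?_
  have h5 : c / Real.log P.N ^ 2 * P.b (k + 1) ≤ 1 / (16 * Real.log P.N) * P.b k := by
    calc c / Real.log P.N ^ 2 * P.b (k + 1) ≤ c / Real.log P.N ^ 2 * (3 * P.b k) := by
          have := h.c_nonneg
          exact mul_le_mul_of_nonneg_left (h.b_succ_le k) (by positivity)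
      _ = 3 * c / Real.log P.N ^ 2 * P.b k := by ring
      _ ≤ _ := mul_le_mul_of_nonneg_right h.early_rate (Nat.cast_nonneg _)
  have h6 : 1 / (16 * Real.log P.N) * P.b₀ ≤ 1 / (16 * Real.log P.N) * P.b k := by gcongr
  have h7 : P.b k * (1 / Real.log P.N) / 8 = 2 * (1 / (16 * Real.log P.N) * P.b k) := by
    field_simp
    ring
  have h8 : P.b₀ / (16 * Real.log P.N) = 1 / (16 * Real.log P.N) * P.b₀ := by ring
  rw [h7, h8]
  linarith

/-- Just after `k₀` there are too few late checkpoints for the path bound. Instead the jump of size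
at least `ϱ / 2` from the last early threshold is used: `b_k` is at most a constant times `b_{k₀}`,
and `b_{k₀} ≥ log⁴ N`. -/
theorem rejectEvent_middle_le (h : P.Regular s₀ T κ c ε) (hX : IsBernoulliSeq Q X p) {k : ℕ}
    (hk : P.k₀ < k) (hk' : k ≤ P.k₀ + ⌈T / P.ϱ⌉₊) (hN : P.b k ≤ P.N) :
    Real.exp (c / Real.log P.N ^ 2 * P.b k) * Q.real (P.rejectEvent X k) ≤
      Real.exp (-(2 * Real.log P.N)) := by
  have hL := h.one_le_log
  have hϱ := h.ϱ_pos
  have hϱ1 := h.ϱ_le_one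
  have hgap : P.ϱ / 2 ≤ P.α - 3 / 2 * P.ϱ - (P.α - 2 * P.ϱ) := by linarith
  have h1 := hX.two_point (h.b_strictMono.monotone hk.le)
    (x₁ := P.α - 3 / 2 * P.ϱ) (x₂ := P.α - 2 * P.ϱ) (by linarith) (by linarith)
  have h2 : Q.real (P.rejectEvent X k) ≤
      Real.exp (-(P.b P.k₀ * (P.α - 3 / 2 * P.ϱ - (P.α - 2 * P.ϱ)) ^ 2 / 8)) := by
    refine le_trans (measureReal_mono fun ω hω => ?_) h1
    refine ⟨le_trans ?_ (hω.1 P.k₀ hk), hω.2.trans ?_⟩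
    · exact mul_le_mul_of_nonneg_right (h.le_threshold_of_le le_rfl) (Nat.cast_nonneg _)
    · exact mul_le_mul_of_nonneg_right (h.threshold_le_of_lt hk hN) (Nat.cast_nonneg _)
  have h3 : (1 + P.ϱ) ^ (k - P.k₀) ≤ Real.exp (T + 1) := by
    have h4 : ((k - P.k₀ : ℕ) : ℝ) ≤ T / P.ϱ + 1 := by
      have h5 : ((k - P.k₀ : ℕ) : ℝ) ≤ ⌈T / P.ϱ⌉₊ := by
        exact_mod_cast (by omega : k - P.k₀ ≤ ⌈T / P.ϱ⌉₊)
      have h6 := Nat.ceil_lt_add_one (show 0 ≤ T / P.ϱ by have := h.T_pos; positivity)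
      linarith
    calc (1 + P.ϱ) ^ (k - P.k₀) ≤ Real.exp P.ϱ ^ (k - P.k₀) := by
          gcongr
          linarith [Real.add_one_le_exp P.ϱ]
      _ = Real.exp (((k - P.k₀ : ℕ) : ℝ) * P.ϱ) := by rw [← Real.exp_nat_mul]
      _ ≤ Real.exp (T + 1) := by
          refine Real.exp_le_exp.mpr ?_
          calc ((k - P.k₀ : ℕ) : ℝ) * P.ϱ ≤ (T / P.ϱ + 1) * P.ϱ := by gcongr
            _ = T + P.ϱ := by field_simp
            _ ≤ T + 1 := by linarith
  have h5 : (P.b k : ℝ) ≤ 2 * Real.exp (T + 1) * P.b P.k₀ := by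
    have h6 := (h.b_lt k).le
    have h7 := h.one_le_real k
    have h8 : P.b₀ * (1 + P.ϱ) ^ k = P.b₀ * (1 + P.ϱ) ^ P.k₀ * (1 + P.ϱ) ^ (k - P.k₀) := by
      rw [mul_assoc, ← pow_add, Nat.add_sub_cancel' hk.le]
    calc (P.b k : ℝ) ≤ 2 * (P.b₀ * (1 + P.ϱ) ^ k) := by linarith
      _ = 2 * (P.b₀ * (1 + P.ϱ) ^ P.k₀ * (1 + P.ϱ) ^ (k - P.k₀)) := by rw [h8]
      _ ≤ 2 * (P.b P.k₀ * Real.exp (T + 1)) := by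
          gcongr
          exact le_b P P.k₀
      _ = _ := by ring
  refine (mul_le_mul_of_nonneg_left h2 (Real.exp_pos _).le).trans ?_
  rw [← Real.exp_add]
  refine Real.exp_le_exp.mpr ?_
  have h6 : c / Real.log P.N ^ 2 * P.b k ≤ P.ϱ ^ 2 / 64 * P.b P.k₀ := by
    calc c / Real.log P.N ^ 2 * P.b k ≤
        c / Real.log P.N ^ 2 * (2 * Real.exp (T + 1) * P.b P.k₀) := by
          have := h.c_nonneg
          gcongr
      _ = 2 * Real.exp (T + 1) * c / Real.log P.N ^ 2 * P.b P.k₀ := by ring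
      _ ≤ _ := mul_le_mul_of_nonneg_right h.middle_rate (Nat.cast_nonneg _)
  have h7 : Real.log P.N ^ 4 * P.ϱ ^ 2 / 64 ≤ P.b P.k₀ * P.ϱ ^ 2 / 64 := by
    have := h.log_pow_le_b le_rfl
    gcongr
  have h8 := h.middle_small
  have h9 : P.b P.k₀ * (P.α - 3 / 2 * P.ϱ - (P.α - 2 * P.ϱ)) ^ 2 / 8 =
      2 * (P.b P.k₀ * P.ϱ ^ 2 / 64) := by ring
  rw [h9]
  linarith

/-- If the mean is well below the threshold, passing the previous test is unlikely; if well above,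
failing this one is. Either costs a constant per sample, far more than order `1 / log² N`. -/
theorem rejectEvent_far_le (h : P.Regular s₀ T κ c ε) (hX : IsBernoulliSeq Q X p) {k : ℕ}
    (hk : P.k₀ < k) (hN : P.b (k + 1) ≤ P.N)
    (hp : κ * s₀ ^ 2 ≤ |p - P.threshold (k + 1)|) :
    Q.real (P.rejectEvent X (k + 1)) ≤
      Real.exp (-((c + ε) / Real.log P.N ^ 2 * P.b (k + 1))) := by
  have hκ := h.κ_pos
  have hs := h.s₀_pos
  have ha0 : 0 ≤ κ * s₀ ^ 2 := by positivity
  have ha1 : κ * s₀ ^ 2 ≤ 1 :=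
    mul_le_one₀ h.κ_le_one (by positivity) (pow_le_one₀ hs.le h.s₀_le_one)
  have hb := h.b_succ_le k
  have h0 : (0 : ℝ) ≤ P.b k := Nat.cast_nonneg _
  have hN' : P.b k ≤ P.N := (h.b_strictMono.monotone (Nat.le_succ k)).trans hN
  have hrate : (c + ε) / Real.log P.N ^ 2 * P.b (k + 1) ≤ P.b k * (κ * s₀ ^ 2) ^ 2 / 2 := by
    calc (c + ε) / Real.log P.N ^ 2 * P.b (k + 1) ≤ (κ * s₀ ^ 2) ^ 2 / 6 * (3 * P.b k) :=
          mul_le_mul h.far_rate hb (Nat.cast_nonneg _) (by positivity)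
      _ = _ := by ring
  rcases le_abs'.mp hp with h1 | h1
  · have hmono : P.threshold (k + 1) ≤ P.threshold k := by
      rw [threshold_of_lt hk, threshold_of_lt (by omega)]
      refine thetaInv_mono ((theta_mem _).1.trans (h.angle_mem hN).1) ?_
        ((h.angle_mem hN').2.trans (theta_mem _).2)
      unfold angle
      have h2 : ((k - P.k₀ : ℕ) : ℝ) ≤ ((k + 1 - P.k₀ : ℕ) : ℝ) := by
        exact_mod_cast Nat.sub_le_sub_right (Nat.le_succ k) _
      have := mul_le_mul_of_nonneg_right h2 h.slope_pos.le
      linarith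
    refine (measureReal_mono fun ω hω => hω.1 k (Nat.lt_succ_self k)).trans
      ((hX.upper_tail (P.b k) ha0 ha1 (by linarith)).trans (Real.exp_le_exp.mpr ?_))
    linarith
  · refine (measureReal_mono fun ω hω => hω.2).trans
      ((hX.lower_tail (P.b (k + 1)) ha0 ha1 (by linarith)).trans (Real.exp_le_exp.mpr ?_))
    have h2 : (P.b k : ℝ) ≤ P.b (k + 1) := by
      exact_mod_cast h.b_strictMono.monotone (Nat.le_succ k)
    have h3 : P.b k * (κ * s₀ ^ 2) ^ 2 / 2 ≤ P.b (k + 1) * (κ * s₀ ^ 2) ^ 2 / 2 := by gcongr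
    linarith

/-- A geometric series of ratio `1 / (1 + ϱ)`. Cutting it after `⌈T / ϱ⌉` terms and undoing the
rounding of `b_k` each lose at most a fraction `1 / (1 + T)`. -/
theorem geometric_le_sum_b (h : P.Regular s₀ T κ c ε) {k : ℕ} (hk : P.k₀ < k)
    (hk' : P.k₀ + ⌈T / P.ϱ⌉₊ < k) :
    P.b k * (1 - 2 / (1 + T)) / P.ϱ ≤
      ∑ l ∈ Finset.range ⌈T / P.ϱ⌉₊, (P.b (k - (l + 1)) : ℝ) := by
  set m := ⌈T / P.ϱ⌉₊ with hm
  have hϱ := h.ϱ_pos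
  have hT := h.T_pos
  set q : ℝ := (1 + P.ϱ)⁻¹ with hq
  have hq1 : 1 + P.ϱ ≠ 0 := by linarith
  have hB := h.b_lt k
  set B : ℝ := P.b₀ * (1 + P.ϱ) ^ k with hBdef
  have h1 : ∀ l ∈ Finset.range m, B * q ^ (l + 1) ≤ (P.b (k - (l + 1)) : ℝ) := by
    intro l hl
    have hl' := Finset.mem_range.mp hl
    refine le_trans (le_of_eq ?_) (le_b P (k - (l + 1)))
    have e : (1 + P.ϱ) ^ k = (1 + P.ϱ) ^ (k - (l + 1)) * (1 + P.ϱ) ^ (l + 1) := by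
      rw [← pow_add, Nat.sub_add_cancel (by omega)]
    rw [hBdef, e, hq, inv_pow]
    field_simp
  have h2 : ∑ l ∈ Finset.range m, q ^ (l + 1) = (1 - q ^ m) / P.ϱ := by
    have hqne : q ≠ 1 := by
      rw [hq]
      have : (1 + P.ϱ)⁻¹ < 1 := inv_lt_one_of_one_lt₀ (by linarith)
      exact this.ne
    simp_rw [pow_succ]
    rw [← Finset.sum_mul, geom_sum_eq hqne]
    have e : q - 1 = -(P.ϱ * q) := by rw [hq]; field_simp; ring
    have hq0 : q ≠ 0 := inv_ne_zero hq1
    rw [e]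
    field_simp
    ring
  have h3 : q ^ m ≤ 1 / (1 + T) := by
    rw [hq, inv_pow, ← one_div]
    refine one_div_le_one_div_of_le (by linarith) ?_
    have h4 := one_add_mul_le_pow (show (-2 : ℝ) ≤ P.ϱ by linarith) m
    have h5 : T ≤ m * P.ϱ := by
      rw [← div_le_iff₀ hϱ]; exact Nat.le_ceil _
    linarith
  have h4 : (P.b k : ℝ) * (1 - 1 / (1 + T)) ≤ B := by
    have h5 : 1 + T ≤ P.b k := h.T_le.trans (h.log_pow_le_b hk.le)
    have h6 : 1 ≤ P.b k * (1 / (1 + T)) := by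
      rw [mul_one_div, one_le_div (by linarith)]; exact h5
    linarith
  have h5 : (0 : ℝ) < 1 - 1 / (1 + T) := by
    rw [sub_pos, div_lt_one (by linarith)]; linarith
  calc P.b k * (1 - 2 / (1 + T)) / P.ϱ
      ≤ P.b k * (1 - 1 / (1 + T)) * (1 - 1 / (1 + T)) / P.ϱ := by
        have e : (1 : ℝ) - 2 / (1 + T) = (1 - 1 / (1 + T)) * (1 - 1 / (1 + T)) -
            (1 / (1 + T)) ^ 2 := by field_simp; ring
        rw [e, mul_assoc]
        gcongr
        linarith [sq_nonneg (1 / (1 + T))]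
    _ ≤ B * (1 - q ^ m) / P.ϱ := by
        gcongr
    _ = ∑ l ∈ Finset.range m, B * q ^ (l + 1) := by
        rw [← Finset.mul_sum, h2]; ring
    _ ≤ _ := Finset.sum_le_sum h1

/-- The sharp case: `path_bound_of_slope` over the last `⌈T / ϱ⌉` checkpoints. In that window the
threshold is nearly linear in the index, and the variance of the arm is nearly that at the
threshold. -/
theorem rejectEvent_near_le (h : P.Regular s₀ T κ c ε) (hX : IsBernoulliSeq Q X p) {k : ℕ}
    (hk : P.k₀ + ⌈T / P.ϱ⌉₊ < k) (hN : P.b k ≤ P.N)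
    (hp : |p - P.threshold k| ≤ κ * s₀ ^ 2) :
    Q.real (P.rejectEvent X k) ≤ Real.exp (-((c + ε) / Real.log P.N ^ 2 * P.b k)) := by
  have hϱ := h.ϱ_pos
  have hL := h.one_le_log
  have hκ := h.κ_pos
  have hs := h.s₀_pos
  have hd := h.dist_pos
  have hT := h.T_pos
  have hδ := h.slope_pos
  have hk0 : P.k₀ < k := by omega
  have hσ : s₀ ≤ Real.sin (P.angle k) / 2 := h.s₀_le_sin _ (h.angle_mem hN)
  have hthr := threshold_of_lt hk0
  set σ := Real.sin (P.angle k) / 2 with hσdef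
  set m := ⌈T / P.ϱ⌉₊ with hm
  have hmT : (m : ℝ) ≤ (T + 1) / P.ϱ := by
    have h1 := Nat.ceil_lt_add_one (show 0 ≤ T / P.ϱ by positivity)
    have h2 : 1 ≤ 1 / P.ϱ := by rw [one_le_div hϱ]; exact h.ϱ_le_one
    rw [add_div]
    linarith
  have hslope : P.slope / P.ϱ = (theta P.α - theta P.β) * (1 - P.ϱ₂) / Real.log P.N := by
    rw [h.slope_eq]; field_simp
  have hmδ : m * P.slope ≤ κ * s₀ / 2 := by
    calc m * P.slope ≤ (T + 1) / P.ϱ * P.slope := by gcongr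
      _ = (T + 1) * (P.slope / P.ϱ) := by ring
      _ ≤ (T + 1) * ((theta P.α - theta P.β) / Real.log P.N) := by
          rw [hslope]
          gcongr
          exact mul_le_of_le_one_right hd.le (by linarith [h.ϱ₂_pos])
      _ ≤ _ := h.tilt_small
  have hanti : Antitone fun l => P.b (k - l) := fun l l' hl =>
    h.b_strictMono.monotone (Nat.sub_le_sub_left hl k)
  have hb0 : 0 < P.b k := by
    have := h.b_strictMono.monotone (Nat.zero_le k)
    rw [b_zero] at this
    exact h.b₀_pos.trans_le this
  have hx : ∀ l < m, ((l : ℝ) + 1) * (σ * P.slope) * (1 - κ) ≤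
      P.threshold (k - (l + 1)) - P.threshold (k - 0) := by
    intro l hl
    rw [Nat.sub_zero, hthr, threshold_of_lt (by omega)]
    have e : P.angle (k - (l + 1)) = P.angle k + ((l : ℝ) + 1) * P.slope := by
      unfold angle
      have e1 : k - P.k₀ = k - (l + 1) - P.k₀ + (l + 1) := by omega
      rw [e1]
      push_cast
      ring
    have hlm : (l : ℝ) + 1 ≤ m := by exact_mod_cast hl
    have hh : 0 ≤ ((l : ℝ) + 1) * P.slope := by positivity
    have h1 := le_thetaInv_add_sub (P.angle k) hh
    have h2 : ((l : ℝ) + 1) * P.slope ≤ κ * σ := by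
      have := mul_le_mul_of_nonneg_right hlm hδ.le
      have := mul_le_mul_of_nonneg_left hσ hκ.le
      nlinarith
    rw [e]
    have h3 := mul_le_mul_of_nonneg_right h2 hh
    have h4 : 0 ≤ κ * σ * (((l : ℝ) + 1) * P.slope) := by
      have : 0 < σ := hs.trans_le hσ
      positivity
    rw [← hσdef] at h1
    linarith
  -- The map `p ↦ p (1 - p)` is `1`-Lipschitz on `[0, 1]`, and `s₀ ≤ σ`; this is why nearness is
  -- measured by `κ s₀²`.
  have hvar : p * (1 - p) ≤ (1 + κ) * σ ^ 2 := by
    have h1 := thetaInv_mul_one_sub (P.angle k)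
    rw [← hthr, ← hσdef] at h1
    obtain ⟨hp0, hp1⟩ := hX.mean_mem
    have hx1 : 0 ≤ P.threshold k ∧ P.threshold k ≤ 1 := by
      rw [hthr, thetaInv]
      constructor <;> linarith [Real.neg_one_le_cos (P.angle k), Real.cos_le_one (P.angle k)]
    have h2 : p * (1 - p) - P.threshold k * (1 - P.threshold k) ≤ |p - P.threshold k| := by
      have e : p * (1 - p) - P.threshold k * (1 - P.threshold k) =
          (p - P.threshold k) * (1 - p - P.threshold k) := by ring
      rw [e]
      refine (le_abs_self _).trans ?_
      rw [abs_mul]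
      refine mul_le_of_le_one_right (abs_nonneg _) ?_
      rw [abs_le]
      constructor <;> linarith [hx1.1, hx1.2]
    have h3 : κ * s₀ ^ 2 ≤ κ * σ ^ 2 := by gcongr
    linarith
  have hexp : Real.exp (P.slope / σ * m) ≤ 1 + κ := by
    have h1 : P.slope / σ * m ≤ κ / 2 := by
      have hσ0 : 0 < σ := hs.trans_le hσ
      rw [div_mul_eq_mul_div, div_le_iff₀ hσ0]
      have := mul_le_mul_of_nonneg_left hσ hκ.le
      linarith
    have h2 := Real.one_sub_le_exp_neg (κ / 2)
    have h3 : Real.exp (-(κ / 2)) * Real.exp (κ / 2) = 1 := by rw [← Real.exp_add]; simp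
    have h4 := Real.exp_pos (κ / 2)
    refine (Real.exp_le_exp.mpr h1).trans ?_
    have h5 : (1 - κ / 2) * Real.exp (κ / 2) ≤ 1 := by nlinarith
    have h6 : 1 ≤ (1 + κ) * (1 - κ / 2) := by nlinarith [h.κ_le_one]
    nlinarith [h.κ_le_one]
  have hG : (P.b (k - 0) : ℝ) * (1 - 2 / (1 + T)) / P.ϱ ≤
      ∑ l ∈ Finset.range m, (P.b (k - (l + 1)) : ℝ) := h.geometric_le_sum_b hk0 hk
  have hpath := hX.path_bound_of_slope hanti hb0 (m := m) (x := fun l => P.threshold (k - l))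
    (hs.trans_le hσ) hδ hϱ hκ.le h.κ_le_one
    (by rw [div_le_one (by linarith)]; linarith [h.one_le_T]) hx hvar hexp hG hmT
  refine le_trans (measureReal_mono fun ω hω => ?_) (hpath.trans (Real.exp_le_exp.mpr ?_))
  · exact ⟨fun l hl => hω.1 (k - (l + 1)) (by omega), hω.2⟩
  · simp only [Nat.sub_zero]
    rw [hslope, neg_le_neg_iff]
    calc (c + ε) / Real.log P.N ^ 2 * P.b k
        ≤ (theta P.α - theta P.β) ^ 2 * (1 - P.ϱ₂) ^ 2 *
          ((1 - 2 / (1 + T)) ^ 2 / 2 - 4 * κ * (T + 1) ^ 2) / Real.log P.N ^ 2 * P.b k := by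
          have := h.near_rate
          gcongr
      _ = _ := by ring

/-- At late checkpoints a rejection costs at least the rate `c` per sample. -/
theorem rejectEvent_late_le (h : P.Regular s₀ T κ c ε) (hX : IsBernoulliSeq Q X p) {k : ℕ}
    (hk : P.k₀ < k) (hN : P.b k ≤ P.N) :
    Real.exp (c / Real.log P.N ^ 2 * P.b k) * Q.real (P.rejectEvent X k) ≤
      Real.exp (-(2 * Real.log P.N)) := by
  rcases le_or_gt k (P.k₀ + ⌈T / P.ϱ⌉₊) with hk' | hk'
  · exact h.rejectEvent_middle_le hX hk hk' hN
  · have h1 : Q.real (P.rejectEvent X k) ≤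
        Real.exp (-((c + ε) / Real.log P.N ^ 2 * P.b k)) := by
      rcases le_total |p - P.threshold k| (κ * s₀ ^ 2) with hp | hp
      · exact h.rejectEvent_near_le hX hk' hN hp
      · have hm : 0 < ⌈T / P.ϱ⌉₊ := Nat.ceil_pos.mpr (div_pos h.T_pos h.ϱ_pos)
        obtain ⟨k, rfl⟩ : ∃ k', k = k' + 1 := ⟨k - 1, by omega⟩
        exact h.rejectEvent_far_le hX (by omega) hN hp
    refine (mul_le_mul_of_nonneg_left h1 (Real.exp_pos _).le).trans ?_
    rw [← Real.exp_add]
    refine Real.exp_le_exp.mpr ?_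
    have hL := h.one_le_log
    have h2 := h.log_pow_le_b hk.le
    -- The surplus rate `ε` over at least `log⁴ N` samples yields the factor `N⁻²`, small enough to
    -- be summed over all checkpoints.
    have h3 : ε * Real.log P.N ^ 2 ≤ ε / Real.log P.N ^ 2 * P.b k := by
      calc ε * Real.log P.N ^ 2 = ε / Real.log P.N ^ 2 * Real.log P.N ^ 4 := by field_simp
        _ ≤ _ := by
          have := h.ε_pos
          gcongr
    have h4 : (c + ε) / Real.log P.N ^ 2 * P.b k =
        c / Real.log P.N ^ 2 * P.b k + ε / Real.log P.N ^ 2 * P.b k := by ring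
    linarith [h.late_small]

end Regular

end Params

/-! ### Expected weights of a single arm -/

namespace Params

namespace Regular

variable {P : Params} {s₀ T κ c ε : ℝ} {p : ℝ}

theorem sum_reward_eq (p : ℝ) (v : ℕ → unitInterval) (n : ℕ) :
    ∑ j ∈ Finset.range n, ((rewardStream (p, v) j).toNat : ℝ) =
      totalReward (rewardStream (p, v)) n := by
  unfold totalReward
  push_cast
  rfl

theorem totalReward_le (r : ℕ → Bool) (n : ℕ) : totalReward r n ≤ n := by
  unfold totalReward
  calc ∑ j ∈ Finset.range n, (r j).toNat ≤ ∑ j ∈ Finset.range n, 1 :=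
        Finset.sum_le_sum fun j _ => Bool.toNat_le _
    _ = n := by simp

theorem b_pos (h : P.Regular s₀ T κ c ε) (k : ℕ) : 0 < P.b k := by
  have := h.b_strictMono.monotone (Nat.zero_le k)
  rw [b_zero] at this
  exact h.b₀_pos.trans_le this

theorem rejectTest_average_iff (h : P.Regular s₀ T κ c ε) {k : ℕ} (hN : P.b k ≤ P.N)
    (r : ℕ → Bool) :
    P.rejectTest k ((totalReward r (P.b k) : ℝ) / P.b k) ↔
      (totalReward r (P.b k) : ℝ) ≤ P.threshold k * P.b k := by
  have hb : (0 : ℝ) < P.b k := by exact_mod_cast h.b_pos k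
  have h1 : (totalReward r (P.b k) : ℝ) ≤ P.b k := by exact_mod_cast totalReward_le r _
  rw [h.rejectTest_iff hN (by positivity) (by rw [div_le_one hb]; exact h1), div_le_iff₀ hb]

theorem threshold_lt_of_alive (h : P.Regular s₀ T κ c ε) {r : ℕ → Bool} {n k : ℕ}
    (hr : P.Alive r n) (hk : P.b k ≤ n) (hN : P.b k ≤ P.N) :
    P.threshold k * P.b k < totalReward r (P.b k) := by
  by_contra hlt
  refine hr (P.b k) (h.b_pos k) hk ⟨k, rfl, ?_⟩
  rw [h.rejectTest_average_iff hN]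
  exact not_lt.mp hlt

/-- Before the first checkpoint survival is free, which gives the right-hand side. Afterwards the
last passed checkpoint `b_k` satisfies `n + 1 ≤ b_{k+1} ≤ 3 b_k`, and its threshold exceeds `β` by a
margin whose tail bound beats the weight. -/
theorem exp_mul_alive_le (h : P.Regular s₀ T κ c ε) (hp0 : 0 ≤ p) (hp : p < P.β) {n : ℕ}
    (hn : n < P.N) :
    Real.exp (c / Real.log P.N ^ 2 * (n + 1 : ℕ)) *
        seedLaw.real {v | P.Alive (rewardStream (p, v)) n} ≤
      Real.exp (c / Real.log P.N ^ 2 * P.b₀) := by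
  have hL := h.one_le_log
  have hc := h.c_nonneg
  have hrate : 0 ≤ c / Real.log P.N ^ 2 := by positivity
  have hX := isBernoulliSeq_rewardStream hp0 (by linarith [h.β_lt_α, h.α_lt_one] : p ≤ 1)
  rcases Nat.lt_or_ge n P.b₀ with hb | hb
  · refine (mul_le_of_le_one_right (Real.exp_pos _).le measureReal_le_one).trans ?_
    refine Real.exp_le_exp.mpr (mul_le_mul_of_nonneg_left ?_ hrate)
    exact_mod_cast hb
  · obtain ⟨k, hk1, hk2⟩ : ∃ k, P.b k ≤ n ∧ n < P.b (k + 1) := by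
      have hex : ∃ k, n < P.b k := ⟨n + 1, h.b_strictMono.le_apply⟩
      have h0 : Nat.find hex ≠ 0 := by
        intro h0
        have := Nat.find_spec hex
        rw [h0, b_zero] at this
        omega
      refine ⟨Nat.find hex - 1, ?_, ?_⟩
      · exact not_lt.mp (Nat.find_min hex (by omega))
      · rw [Nat.sub_add_cancel (by omega)]
        exact Nat.find_spec hex
    have hN : P.b k ≤ P.N := by omega
    have hb0 : (0 : ℝ) ≤ P.b k := Nat.cast_nonneg _
    have htail : ∀ a : ℝ, 0 ≤ a → a ≤ 1 → P.β + a ≤ P.threshold k →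
        3 * c / Real.log P.N ^ 2 ≤ a ^ 2 / 2 →
        Real.exp (c / Real.log P.N ^ 2 * (n + 1 : ℕ)) *
        seedLaw.real {v | P.Alive (rewardStream (p, v)) n} ≤ 1 := by
      intro a ha0 ha1 hthr ha
      have h1 := hX.upper_tail (P.b k) ha0 ha1 (x := P.threshold k) (by linarith)
      have h2 : seedLaw.real {v | P.Alive (rewardStream (p, v)) n} ≤
          Real.exp (-(P.b k * a ^ 2 / 2)) := by
        refine le_trans (measureReal_mono fun v hv => ?_) h1
        simp only [Set.mem_ofPred_eq] at hv ⊢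
        rw [sum_reward_eq]
        exact (h.threshold_lt_of_alive hv hk1 hN).le
      refine (mul_le_mul_of_nonneg_left h2 (Real.exp_pos _).le).trans ?_
      rw [← Real.exp_add, Real.exp_le_one_iff]
      have h3 : ((n + 1 : ℕ) : ℝ) ≤ 3 * P.b k :=
        le_trans (by exact_mod_cast hk2) (h.b_succ_le k)
      have h4 := mul_le_mul_of_nonneg_left h3 hrate
      have h5 := mul_le_mul_of_nonneg_left ha hb0
      have h6 : c / Real.log P.N ^ 2 * (3 * P.b k) = P.b k * (3 * c / Real.log P.N ^ 2) := by ring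
      linarith
    refine le_trans ?_ (Real.one_le_exp (mul_nonneg hrate (Nat.cast_nonneg P.b₀)))
    rcases Nat.lt_or_ge P.k₀ k with hk | hk
    · have hd := h.dist_pos
      have h2 := h.ϱ₂_pos
      have h3 := h.s₀_pos
      have h4 := h.β_add_le_threshold hk hN
      refine htail _ (by positivity) ?_ h4 h.alive_late
      linarith [h.threshold_le_of_lt hk hN, h.ϱ_pos, h.α_lt_one, h.β_pos]
    · have h4 := h.le_threshold_of_le hk
      refine htail _ (by linarith [h.β_lt_α]) ?_ ?_ h.alive_early
      · linarith [h.α_lt_one, h.β_pos]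
      · linarith [h.four_ϱ_le, h.ϱ_pos]

theorem lintegral_aliveWeight_le (h : P.Regular s₀ T κ c ε) (hp0 : 0 ≤ p) (hp : p < P.β) :
    ∫⁻ v, P.aliveWeight (c / Real.log P.N ^ 2) (rewardStream (p, v)) ∂seedLaw ≤
      ENNReal.ofReal (P.N * Real.exp (c / Real.log P.N ^ 2 * P.b₀)) := by
  classical
  have hm : Measurable fun v => rewardStream (p, v) := measurable_rewardStream.comp (by fun_prop)
  have hset : ∀ n, MeasurableSet {v | P.Alive (rewardStream (p, v)) n} := fun n =>
    hm (P.measurableSet_alive n)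
  have e : ∀ v, P.aliveWeight (c / Real.log P.N ^ 2) (rewardStream (p, v)) =
      ∑ n ∈ Finset.range P.N, {v | P.Alive (rewardStream (p, v)) n}.indicator
        (fun _ => ENNReal.ofReal (Real.exp (c / Real.log P.N ^ 2 * (n + 1 : ℕ)))) v := by
    intro v
    unfold aliveWeight
    refine Finset.sum_congr rfl fun n _ => ?_
    simp [Set.indicator_apply]
  simp_rw [e]
  rw [lintegral_finsetSum _ fun n _ => measurable_const.indicator (hset n)]
  calc _ ≤ ∑ n ∈ Finset.range P.N,
        ENNReal.ofReal (Real.exp (c / Real.log P.N ^ 2 * P.b₀)) := by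
        refine Finset.sum_le_sum fun n hn => ?_
        rw [lintegral_indicator_const (hset n), ← ofReal_measureReal,
          ← ENNReal.ofReal_mul (Real.exp_pos _).le]
        exact ENNReal.ofReal_le_ofReal (h.exp_mul_alive_le hp0 hp (Finset.mem_range.mp hn))
    _ = _ := by
        rw [Finset.sum_const, Finset.card_range, nsmul_eq_mul,
          ENNReal.ofReal_mul (Nat.cast_nonneg _), ENNReal.ofReal_natCast]

theorem sum_exp_mul_rejectEvent_le (h : P.Regular s₀ T κ c ε) {Ω : Type*} [MeasurableSpace Ω]
    {Q : Measure Ω} [IsProbabilityMeasure Q] {X : ℕ → Ω → ℝ} (hX : IsBernoulliSeq Q X p) :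
    ∑ k ∈ (Finset.range P.N).filter (fun k => P.b k ≤ P.N),
        Real.exp (c / Real.log P.N ^ 2 * P.b k) * Q.real (P.rejectEvent X k) ≤
      Real.exp (c / Real.log P.N ^ 2 * P.b₀) * Q.real (P.rejectEvent X 0) +
        P.k₀ * Real.exp (-(P.b₀ / (16 * Real.log P.N))) + Real.exp (-Real.log P.N) := by
  set A := Real.exp (-(P.b₀ / (16 * Real.log P.N))) with hA
  set B := Real.exp (-(2 * Real.log P.N)) with hB
  set f := Real.exp (c / Real.log P.N ^ 2 * P.b₀) * Q.real (P.rejectEvent X 0) with hf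
  have hA0 : 0 < A := Real.exp_pos _
  have hB0 : 0 < B := Real.exp_pos _
  have hf0 : 0 ≤ f := mul_nonneg (Real.exp_pos _).le measureReal_nonneg
  have hB1 : P.N * B = Real.exp (-Real.log P.N) := by
    have e : P.N * B = Real.exp (Real.log P.N) * B := by rw [h.exp_log]
    rw [e, hB, ← Real.exp_add]
    congr 1; ring
  have hterm : ∀ k ∈ (Finset.range P.N).filter (fun k => P.b k ≤ P.N),
      Real.exp (c / Real.log P.N ^ 2 * P.b k) * Q.real (P.rejectEvent X k) ≤
      (if k = 0 then f else 0) + (if k ∈ Finset.Icc 1 P.k₀ then A else 0) + B := by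
    intro k hk
    have hN := (Finset.mem_filter.mp hk).2
    rcases Nat.eq_zero_or_pos k with rfl | hk0
    · simp only [b_zero, if_true]
      have : 0 ≤ (if 0 ∈ Finset.Icc 1 P.k₀ then A else 0) := by split_ifs <;> positivity
      linarith
    · rw [if_neg hk0.ne', zero_add]
      rcases Nat.lt_or_ge P.k₀ k with hk1 | hk1
      · rw [if_neg (by simp; omega), zero_add]
        exact h.rejectEvent_late_le hX hk1 hN
      · rw [if_pos (by simp; omega)]
        obtain ⟨k, rfl⟩ : ∃ k', k = k' + 1 := ⟨k - 1, by omega⟩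
        linarith [h.rejectEvent_early_le hX hk1]
  have h1 : ∑ k ∈ Finset.range P.N, (if k = 0 then f else 0) ≤ f := by
    rw [Finset.sum_ite_eq']
    split_ifs <;> linarith
  have h2 : ∑ k ∈ Finset.range P.N, (if k ∈ Finset.Icc 1 P.k₀ then A else 0) ≤ P.k₀ * A := by
    rw [← Finset.sum_filter, Finset.sum_const, nsmul_eq_mul]
    refine mul_le_mul_of_nonneg_right ?_ hA0.le
    have : ((Finset.range P.N).filter (· ∈ Finset.Icc 1 P.k₀)).card ≤ (Finset.Icc 1 P.k₀).card :=
      Finset.card_le_card fun k hk => (Finset.mem_filter.mp hk).2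
    rw [Nat.card_Icc] at this
    exact_mod_cast this
  have h3 : ∑ k ∈ Finset.range P.N, B = P.N * B := by simp
  calc _ ≤ ∑ k ∈ (Finset.range P.N).filter (fun k => P.b k ≤ P.N),
      ((if k = 0 then f else 0) + (if k ∈ Finset.Icc 1 P.k₀ then A else 0) + B) :=
        Finset.sum_le_sum hterm
    _ ≤ ∑ k ∈ Finset.range P.N,
      ((if k = 0 then f else 0) + (if k ∈ Finset.Icc 1 P.k₀ then A else 0) + B) := by
        refine Finset.sum_le_sum_of_subset_of_nonneg (Finset.filter_subset _ _) fun k _ _ => ?_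
        have : 0 ≤ (if k ∈ Finset.Icc 1 P.k₀ then A else 0) := by split_ifs <;> positivity
        have : 0 ≤ (if k = 0 then f else 0) := by split_ifs <;> linarith
        linarith
    _ ≤ _ := by
        rw [Finset.sum_add_distrib, Finset.sum_add_distrib, h3, hB1]
        linarith

theorem lintegral_rejectWeight_le (h : P.Regular s₀ T κ c ε) (hp0 : 0 ≤ p) (hp1 : p ≤ 1) :
    ∫⁻ v, P.rejectWeight (c / Real.log P.N ^ 2) (rewardStream (p, v)) ∂seedLaw ≤
      ENNReal.ofReal (Real.exp (c / Real.log P.N ^ 2 * P.b₀) * seedLaw.real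
          (P.rejectEvent (fun n v => ((rewardStream (p, v) n).toNat : ℝ)) 0) +
        P.k₀ * Real.exp (-(P.b₀ / (16 * Real.log P.N))) + Real.exp (-Real.log P.N)) := by
  classical
  set l := c / Real.log P.N ^ 2 with hl
  have hm : Measurable fun v => rewardStream (p, v) := measurable_rewardStream.comp (by fun_prop)
  set R : ℕ → Set (ℕ → unitInterval) := fun n => {v | P.Alive (rewardStream (p, v)) n ∧
    P.rejects (n + 1) (totalReward (rewardStream (p, v)) (n + 1))} with hR
  set E := P.rejectEvent (fun n v => ((rewardStream (p, v) n).toNat : ℝ)) with hE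
  have hset : ∀ n, MeasurableSet (R n) := fun n =>
    hm ((P.measurableSet_alive n).inter (P.measurableSet_rejects (n + 1)))
  have e : ∀ v, P.rejectWeight l (rewardStream (p, v)) =
      ∑ n ∈ Finset.range P.N, (R n).indicator
        (fun _ => ENNReal.ofReal (Real.exp (l * (n + 1 : ℕ)))) v := by
    intro v
    unfold rejectWeight
    refine Finset.sum_congr rfl fun n _ => ?_
    simp [Set.indicator_apply, hR]
  simp_rw [e]
  rw [lintegral_finsetSum _ fun n _ => measurable_const.indicator (hset n)]
  set S := (Finset.range P.N).filter (fun k => P.b k ≤ P.N) with hS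
  -- Rejection at sample `n + 1` forces `n + 1` to be a checkpoint `b_k`. Its index lies in `S`
  -- because `k < b_k ≤ N`.
  have hRE : ∀ n < P.N, seedLaw (R n) ≤
      ∑ k ∈ S, if n + 1 = P.b k then seedLaw (E k) else 0 := by
    intro n hn
    by_cases hex : ∃ k, n + 1 = P.b k
    · obtain ⟨k, hk⟩ := hex
      have hkS : k ∈ S := by
        have h1 : k < P.b k := by
          have h2 : ∀ j, j + 1 ≤ P.b j := fun j => by
            induction j with
            | zero => exact h.b_pos 0
            | succ j ih => exact ih.trans_lt (h.b_strictMono (Nat.lt_succ_self j))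
          exact h2 k
        rw [hS, Finset.mem_filter, Finset.mem_range]
        omega
      refine le_trans ?_ (Finset.single_le_sum (fun _ _ => zero_le) hkS)
      rw [if_pos hk]
      refine measure_mono fun v hv => ?_
      obtain ⟨hal, k', hk', htest⟩ := hv
      obtain rfl : k' = k := h.b_strictMono.injective (hk'.symm.trans hk)
      refine ⟨fun k'' hk'' => ?_, ?_⟩
      · rw [sum_reward_eq]
        have hlt := h.b_strictMono hk''
        exact (h.threshold_lt_of_alive hal (by omega) (by omega)).le
      · rw [sum_reward_eq]
        rw [hk] at htest
        exact (h.rejectTest_average_iff (by omega) _).mp htest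
    · have : R n = ∅ := by
        ext v
        simp only [hR, Set.mem_ofPred_eq, Set.mem_empty_iff_false, iff_false, not_and]
        rintro _ ⟨k, hk, _⟩
        exact hex ⟨k, hk⟩
      rw [this, measure_empty]
      exact zero_le
  calc _ ≤ ∑ n ∈ Finset.range P.N, ∑ k ∈ S,
        (if n = P.b k - 1 then ENNReal.ofReal (Real.exp (l * P.b k)) * seedLaw (E k) else 0) := by
        refine Finset.sum_le_sum fun n hn => ?_
        rw [lintegral_indicator_const (hset n)]
        refine (mul_le_mul_right (hRE n (Finset.mem_range.mp hn)) _).trans ?_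
        rw [Finset.mul_sum]
        refine Finset.sum_le_sum fun k _ => ?_
        by_cases hk : n + 1 = P.b k
        · rw [if_pos hk, if_pos (by omega), hk]
        · rw [if_neg hk, mul_zero]
          exact zero_le
    _ ≤ ∑ k ∈ S, ENNReal.ofReal (Real.exp (l * P.b k)) * seedLaw (E k) := by
        rw [Finset.sum_comm]
        refine Finset.sum_le_sum fun k _ => ?_
        rw [Finset.sum_ite_eq']
        split_ifs
        · exact le_rfl
        · exact zero_le
    _ = ENNReal.ofReal (∑ k ∈ S, Real.exp (l * P.b k) * seedLaw.real (E k)) := by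
        rw [ENNReal.ofReal_sum_of_nonneg fun k _ =>
          mul_nonneg (Real.exp_pos _).le measureReal_nonneg]
        refine Finset.sum_congr rfl fun k _ => ?_
        rw [ENNReal.ofReal_mul (Real.exp_pos _).le, ofReal_measureReal]
    _ ≤ _ := ENNReal.ofReal_le_ofReal
        (h.sum_exp_mul_rejectEvent_le (isBernoulliSeq_rewardStream hp0 hp1))

end Regular

end Params

/-! ### The failure probability -/

/-- Every `τ < α` lies below the quantile, so the distribution function is at most `1 - η` there;
the mass of `Iio α` is its left limit at `α`. The support in `[0, 1]` makes the set in the infimum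
bounded below. -/
theorem measure_Iio_le_of_le_quantile {μ : Measure ℝ} [IsProbabilityMeasure μ]
    (hμ : μ (Set.Icc 0 1) = 1) {α η : ℝ} (hη : η < 1) (hq : α ≤ quantile μ (1 - η)) :
    μ (Set.Iio α) ≤ ENNReal.ofReal (1 - η) := by
  have hneg : ∀ τ < 0, cdf μ τ = 0 := by
    intro τ hτ
    rw [cdf_eq_real, measureReal_def]
    have h1 : μ (Set.Icc 0 1)ᶜ = 0 := by
      rw [prob_compl_eq_zero_iff measurableSet_Icc]; exact hμ
    rw [measure_mono_null (fun x hx => ?_) h1, ENNReal.toReal_zero]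
    intro hx'
    exact absurd (hx'.1.trans hx) (not_le.mpr hτ)
  have hbdd : BddBelow {τ : ℝ | 1 - η ≤ cdf μ τ} := by
    refine ⟨0, fun τ hτ => ?_⟩
    by_contra hlt
    rw [Set.mem_ofPred_eq, hneg τ (not_le.mp hlt)] at hτ
    linarith
  have hlt : ∀ τ < α, cdf μ τ ≤ 1 - η := by
    intro τ hτ
    by_contra hcon
    have : quantile μ (1 - η) ≤ τ := csInf_le hbdd (not_le.mp hcon).le
    linarith
  have h1 := (cdf μ).measure_Iio (tendsto_cdf_atBot μ) α
  rw [measure_cdf, sub_zero] at h1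
  rw [h1]
  refine ENNReal.ofReal_le_ofReal ?_
  refine le_of_tendsto ((cdf μ).mono.tendsto_leftLim α) ?_
  exact eventually_nhdsWithin_of_forall hlt

namespace Params.Regular

variable {P : Params} {s₀ T κ c ε s η : ℝ} {μ : Measure ℝ} [IsProbabilityMeasure μ]

/-- The expected weight is at most `1 + s` below `α` and at most `s` from `α` on, and the mass below
`α` is at most `1 - η`. With `s ≤ η` the average does not exceed `1`, so its powers stay bounded
however many arms are rejected. -/
theorem lintegral_rejectWeight_le_one (h : P.Regular s₀ T κ c ε) (hμ : μ (Set.Icc 0 1) = 1)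
    (hη : η < 1) (hq : P.α ≤ quantile μ (1 - η)) (hs0 : 0 ≤ s) (hs : s ≤ η)
    (h1 : Real.exp (c / Real.log P.N ^ 2 * P.b₀) +
      P.k₀ * Real.exp (-(P.b₀ / (16 * Real.log P.N))) + Real.exp (-Real.log P.N) ≤ 1 + s)
    (h2 : Real.exp (c / Real.log P.N ^ 2 * P.b₀) * Real.exp (-(P.b₀ * P.ϱ ^ 2 / 2)) +
      P.k₀ * Real.exp (-(P.b₀ / (16 * Real.log P.N))) + Real.exp (-Real.log P.N) ≤ s) :
    ∫⁻ p, ∫⁻ v, P.rejectWeight (c / Real.log P.N ^ 2) (rewardStream (p, v)) ∂seedLaw ∂μ ≤ 1 := by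
  have hae : ∀ᵐ p ∂μ, p ∈ Set.Icc (0 : ℝ) 1 :=
    (mem_ae_iff_prob_eq_one measurableSet_Icc).mpr hμ
  have hle : ∀ᵐ p ∂μ,
      ∫⁻ v, P.rejectWeight (c / Real.log P.N ^ 2) (rewardStream (p, v)) ∂seedLaw ≤
      ENNReal.ofReal s + (Set.Iio P.α).indicator 1 p := by
    filter_upwards [hae] with p hp
    have hX := isBernoulliSeq_rewardStream hp.1 hp.2
    refine (h.lintegral_rejectWeight_le hp.1 hp.2).trans ?_
    by_cases hpα : p < P.α
    · rw [Set.indicator_of_mem (show p ∈ Set.Iio P.α from hpα), Pi.one_apply,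
        ← ENNReal.ofReal_one, ← ENNReal.ofReal_add hs0 zero_le_one]
      refine ENNReal.ofReal_le_ofReal ?_
      have := mul_le_of_le_one_right (Real.exp_pos (c / Real.log P.N ^ 2 * P.b₀)).le
        (measureReal_le_one (μ := seedLaw)
          (s := P.rejectEvent (fun n v => ((rewardStream (p, v) n).toNat : ℝ)) 0))
      linarith
    · rw [Set.indicator_of_notMem (show p ∉ Set.Iio P.α from hpα), add_zero]
      refine ENNReal.ofReal_le_ofReal ?_
      have := mul_le_mul_of_nonneg_left (h.rejectEvent_zero_le hX (not_lt.mp hpα))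
        (Real.exp_pos (c / Real.log P.N ^ 2 * P.b₀)).le
      linarith
  refine (lintegral_mono_ae hle).trans ?_
  rw [lintegral_add_left measurable_const, lintegral_const, measure_univ, mul_one,
    lintegral_indicator_one measurableSet_Iio]
  calc ENNReal.ofReal s + μ (Set.Iio P.α) ≤ ENNReal.ofReal s + ENNReal.ofReal (1 - η) := by
        gcongr
        exact measure_Iio_le_of_le_quantile hμ hη hq
    _ = ENNReal.ofReal (s + (1 - η)) := (ENNReal.ofReal_add hs0 (by linarith)).symm
    _ ≤ 1 := by
        rw [← ENNReal.ofReal_one]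
        exact ENNReal.ofReal_le_ofReal (by linarith)

theorem lintegral_aliveWeight_indicator_le (h : P.Regular s₀ T κ c ε)
    (hμ : μ (Set.Icc 0 1) = 1) :
    ∫⁻ p, ∫⁻ v, P.aliveWeight (c / Real.log P.N ^ 2) (rewardStream (p, v)) *
      (Set.Iio P.β).indicator 1 p ∂seedLaw ∂μ ≤
      ENNReal.ofReal (P.N * Real.exp (c / Real.log P.N ^ 2 * P.b₀)) := by
  have hae : ∀ᵐ p ∂μ, p ∈ Set.Icc (0 : ℝ) 1 :=
    (mem_ae_iff_prob_eq_one measurableSet_Icc).mpr hμ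
  have hle : ∀ᵐ p ∂μ,
      ∫⁻ v, P.aliveWeight (c / Real.log P.N ^ 2) (rewardStream (p, v)) *
        (Set.Iio P.β).indicator 1 p ∂seedLaw ≤
      ENNReal.ofReal (P.N * Real.exp (c / Real.log P.N ^ 2 * P.b₀)) := by
    filter_upwards [hae] with p hp
    by_cases hpβ : p < P.β
    · rw [Set.indicator_of_mem (show p ∈ Set.Iio P.β from hpβ)]
      simpa using h.lintegral_aliveWeight_le hp.1 hpβ
    · rw [Set.indicator_of_notMem (show p ∉ Set.Iio P.β from hpβ)]
      simp
  refine (lintegral_mono_ae hle).trans ?_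
  simp

theorem failureProb_le (h : P.Regular s₀ T κ c ε) (hμ : μ (Set.Icc 0 1) = 1)
    (hη : η < 1) (hq : P.α ≤ quantile μ (1 - η)) (hs0 : 0 ≤ s) (hs : s ≤ η)
    (h1 : Real.exp (c / Real.log P.N ^ 2 * P.b₀) +
      P.k₀ * Real.exp (-(P.b₀ / (16 * Real.log P.N))) + Real.exp (-Real.log P.N) ≤ 1 + s)
    (h2 : Real.exp (c / Real.log P.N ^ 2 * P.b₀) * Real.exp (-(P.b₀ * P.ϱ ^ 2 / 2)) +
      P.k₀ * Real.exp (-(P.b₀ / (16 * Real.log P.N))) + Real.exp (-Real.log P.N) ≤ s) :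
    P.algorithm.failureProb P.N μ P.β ≤ ENNReal.ofReal
      (Real.exp (2 * Real.log P.N + 1 - c / Real.log P.N ^ 2 * P.N)) := by
  set l := c / Real.log P.N ^ 2 with hl
  have hN : 1 ≤ P.N := by
    have := h.one_le_log
    rcases Nat.eq_zero_or_pos P.N with h0 | h0
    · rw [h0] at this; norm_num at this
    · exact h0
  have hg := h.lintegral_rejectWeight_le_one hμ hη hq hs0 hs h1 h2
  have hz := h.lintegral_aliveWeight_indicator_le hμ
  have hmain := P.exp_mul_failureProb_le l hN P.β μ
  -- Hypothesis `h1` gives the bound `1 + s ≤ 2 ≤ e`.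
  have hb : Real.exp (l * P.b₀) ≤ Real.exp 1 := by
    have h3 : 0 ≤ P.k₀ * Real.exp (-(P.b₀ / (16 * Real.log P.N))) := by positivity
    have h4 := Real.exp_pos (-Real.log P.N)
    have h5 := Real.add_one_le_exp 1
    linarith
  have hsum : ∑ I ∈ Finset.range P.N,
        (∫⁻ p, ∫⁻ v, P.rejectWeight l (rewardStream (p, v)) ∂seedLaw ∂μ) ^ I *
        ∫⁻ p, ∫⁻ v, P.aliveWeight l (rewardStream (p, v)) * (Set.Iio P.β).indicator 1 p
          ∂seedLaw ∂μ ≤ ENNReal.ofReal (P.N * (P.N * Real.exp (l * P.b₀))) := by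
    calc _ ≤ ∑ I ∈ Finset.range P.N, ENNReal.ofReal (P.N * Real.exp (l * P.b₀)) := by
          refine Finset.sum_le_sum fun I _ => ?_
          calc _ ≤ 1 * ENNReal.ofReal (P.N * Real.exp (l * P.b₀)) :=
                mul_le_mul' (pow_le_one₀ zero_le hg) hz
            _ = _ := one_mul _
      _ = _ := by
          rw [Finset.sum_const, Finset.card_range, nsmul_eq_mul,
            ENNReal.ofReal_mul (Nat.cast_nonneg P.N) (q := P.N * _), ENNReal.ofReal_natCast]
  have hpos := Real.exp_pos (l * P.N)
  have h3 : P.algorithm.failureProb P.N μ P.β ≤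
      ENNReal.ofReal (P.N * (P.N * Real.exp (l * P.b₀))) /
        ENNReal.ofReal (Real.exp (l * P.N)) := by
    rw [ENNReal.le_div_iff_mul_le (Or.inl (by simpa using hpos)) (Or.inl ENNReal.ofReal_ne_top),
      mul_comm]
    exact hmain.trans hsum
  refine h3.trans ?_
  rw [← ENNReal.ofReal_div_of_pos hpos]
  refine ENNReal.ofReal_le_ofReal ?_
  rw [div_le_iff₀ hpos, ← Real.exp_add]
  have e : 2 * Real.log P.N + 1 - l * P.N + l * P.N = Real.log P.N + (Real.log P.N + 1) := by ring
  rw [e, Real.exp_add, Real.exp_add, h.exp_log]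
  gcongr

end Params.Regular

/-! ### The choice of the tuning constants -/

/-- The basic tuning rate: a small negative power of `log N`. -/
noncomputable def tuning (N : ℕ) : ℝ := (Real.log N + 2) ^ (-(1 / 32) : ℝ)

/-- The parameters with `ϱ = tuning N ^ 4`, `ϱ₁ = tuning N ^ 2` and `ϱ₂ = tuning N`. -/
noncomputable def tunedParams (α β : ℝ) (N : ℕ) : Params :=
  ⟨N, α, β, tuning N ^ 4, tuning N ^ 2, tuning N⟩

theorem log_add_two_pos (N : ℕ) : 1 < Real.log N + 2 := by
  linarith [Real.log_natCast_nonneg N]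

theorem tuning_pos (N : ℕ) : 0 < tuning N :=
  Real.rpow_pos_of_pos (by linarith [log_add_two_pos N]) _

theorem tuning_lt_one (N : ℕ) : tuning N < 1 :=
  Real.rpow_lt_one_of_one_lt_of_neg (log_add_two_pos N) (by norm_num)

theorem tuning_pow_mul (N : ℕ) : tuning N ^ 32 * (Real.log N + 2) = 1 := by
  have h : 0 < Real.log N + 2 := by linarith [log_add_two_pos N]
  rw [tuning, ← Real.rpow_natCast, ← Real.rpow_mul h.le]
  norm_num
  rw [Real.rpow_neg h.le, Real.rpow_one, inv_mul_cancel₀ h.ne']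

theorem tendsto_log_natCast : Tendsto (fun N : ℕ => Real.log N) atTop atTop :=
  Real.tendsto_log_atTop.comp tendsto_natCast_atTop_atTop

theorem tendsto_tuning : Tendsto tuning atTop (𝓝 0) :=
  (tendsto_rpow_neg_atTop (by norm_num : (0 : ℝ) < 1 / 32)).comp
    (tendsto_atTop_add_const_right _ 2 tendsto_log_natCast)

/-- As `log N + 2 = tuning N ^ (-32)`, the power `8` costs only a quarter of the exponent of `log
N`. This one limit supplies all the largeness conditions on `N`. -/
theorem tendsto_tuning_pow_mul_log :
    Tendsto (fun N => tuning N ^ 8 * Real.log N) atTop atTop := by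
  have h1 : Tendsto (fun N : ℕ => (Real.log N + 2) ^ (3 / 4 : ℝ) - 2) atTop atTop :=
    tendsto_atTop_add_const_right _ (-2) ((tendsto_rpow_atTop (by norm_num)).comp
      (tendsto_atTop_add_const_right _ 2 tendsto_log_natCast))
  refine tendsto_atTop_mono (fun N => ?_) h1
  have h : 0 < Real.log N + 2 := by linarith [log_add_two_pos N]
  have h2 : tuning N ^ 8 * (Real.log N + 2) = (Real.log N + 2) ^ (3 / 4 : ℝ) := by
    rw [tuning, ← Real.rpow_natCast, ← Real.rpow_mul h.le]
    nth_rewrite 2 [← Real.rpow_one (Real.log N + 2)]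
    rw [← Real.rpow_add h]
    norm_num
  have h3 : tuning N ^ 8 ≤ 1 := pow_le_one₀ (tuning_pos N).le (tuning_lt_one N).le
  linarith

section Estimates

variable {α β : ℝ} {N : ℕ}

theorem tunedParams_b₀_ge : tuning N ^ 2 * Real.log N ^ 2 ≤ (tunedParams α β N).b₀ :=
  Nat.le_ceil _

theorem tunedParams_b₀_le : ((tunedParams α β N).b₀ : ℝ) ≤ tuning N ^ 2 * Real.log N ^ 2 + 1 :=
  (Nat.ceil_lt_add_one (mul_nonneg (sq_nonneg (tuning N)) (sq_nonneg (Real.log N)))).le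

/-- With `r = tuning N`, the numerator `log (log⁴ N / b₀)` is at most `128 / r` since `log N ≤
r⁻³²`, and `log (1 + ϱ) ≥ r⁴ / 2`. Rounding up turns `256` into `257`. -/
theorem tunedParams_k₀_mul_le (hL : 1 ≤ Real.log N) (hb : 1 ≤ (tunedParams α β N).b₀) :
    (tunedParams α β N).k₀ * tuning N ^ 5 ≤ 257 := by
  have hr := tuning_pos N
  have hr1 := tuning_lt_one N
  set r := tuning N with hrdef
  have hx : Real.logb (1 + r ^ 4) (Real.log N ^ 4 / (tunedParams α β N).b₀) ≤ 256 / r ^ 5 := by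
    have hb' : (1 : ℝ) ≤ (tunedParams α β N).b₀ := by exact_mod_cast hb
    have h1 : Real.log (Real.log N ^ 4 / (tunedParams α β N).b₀) ≤ 128 / r := by
      have h2 : Real.log N ^ 4 / (tunedParams α β N).b₀ ≤ (1 / r) ^ 128 := by
        have h3 : Real.log N ≤ (1 / r) ^ 32 := by
          rw [div_pow, one_pow, le_div_iff₀ (by positivity)]
          have := tuning_pow_mul N
          have : 0 < r ^ 32 := by positivity
          linarith
        calc Real.log N ^ 4 / (tunedParams α β N).b₀ ≤ Real.log N ^ 4 := by
              exact div_le_self (by positivity) hb'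
          _ ≤ ((1 / r) ^ 32) ^ 4 := by gcongr
          _ = _ := by rw [← pow_mul]
      have h4 := Real.log_le_log (by positivity) h2
      rw [Real.log_pow] at h4
      have h5 := Real.log_le_sub_one_of_pos (show 0 < 1 / r by positivity)
      have h6 : 128 / r = 128 * (1 / r) := by ring
      rw [h6]
      push_cast at h4
      linarith
    have h7 : r ^ 4 / 2 ≤ Real.log (1 + r ^ 4) := by
      have h8 := Real.one_sub_inv_le_log_of_pos (show 0 < 1 + r ^ 4 by positivity)
      have h9 : r ^ 4 ≤ 1 := pow_le_one₀ hr.le hr1.le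
      refine le_trans ?_ h8
      have h10 : 1 - (1 + r ^ 4)⁻¹ = r ^ 4 / (1 + r ^ 4) := by field_simp; ring
      rw [h10]
      gcongr
      linarith
    have h11 : 0 < Real.log (1 + r ^ 4) := lt_of_lt_of_le (by positivity) h7
    rw [Real.logb, div_le_iff₀ h11]
    refine h1.trans ?_
    calc 128 / r = 256 / r ^ 5 * (r ^ 4 / 2) := by field_simp; norm_num
      _ ≤ _ := by gcongr
  have h12 : ((tunedParams α β N).k₀ : ℝ) ≤ 256 / r ^ 5 + 1 := by
    have h13 : (tunedParams α β N).k₀ ≤ ⌈256 / r ^ 5⌉₊ := Nat.ceil_mono hx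
    have h14 := (Nat.ceil_lt_add_one (show 0 ≤ 256 / r ^ 5 by positivity)).le
    exact le_trans (by exact_mod_cast h13) h14
  have h15 : r ^ 5 ≤ 1 := pow_le_one₀ hr.le hr1.le
  calc (tunedParams α β N).k₀ * r ^ 5 ≤ (256 / r ^ 5 + 1) * r ^ 5 := by gcongr
    _ = 256 + r ^ 5 := by field_simp
    _ ≤ 257 := by linarith

theorem tunedParams_k₀_div_le (hL : 1 ≤ Real.log N) (hb : 1 ≤ (tunedParams α β N).b₀)
    (hr : tuning N ≤ 1 / 2056) :
    (tunedParams α β N).k₀ / Real.sqrt (Real.log N) ≤ tuning N ^ 4 / 2 := by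
  have h1 := tunedParams_k₀_mul_le hL hb
  have hr0 := tuning_pos N
  have h2 := tuning_pow_mul N
  set r := tuning N with hrdef
  have h3 : 1 / 2 ≤ r ^ 16 * Real.sqrt (Real.log N) := by
    have h4 : (1 / 2 : ℝ) ^ 2 ≤ (r ^ 16 * Real.sqrt (Real.log N)) ^ 2 := by
      rw [mul_pow, Real.sq_sqrt (by linarith), ← pow_mul]
      have : 0 < r ^ 32 := by positivity
      norm_num
      nlinarith
    exact le_of_sq_le_sq h4 (by positivity)
  rw [div_le_iff₀ (Real.sqrt_pos.mpr (by linarith))]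
  have h5 : r ^ 7 ≤ 1 / 2056 := by
    have : r ^ 6 ≤ 1 := pow_le_one₀ hr0.le (by linarith)
    calc r ^ 7 = r * r ^ 6 := by ring
      _ ≤ r * 1 := by gcongr
      _ ≤ _ := by linarith
  have h6 : (tunedParams α β N).k₀ * r ^ 5 * r ^ 7 ≤ 1 / 8 := by
    calc (tunedParams α β N).k₀ * r ^ 5 * r ^ 7 ≤ 257 * (1 / 2056) := by gcongr
      _ = 1 / 8 := by norm_num
  have h7 : 0 < r ^ 12 := by positivity
  have h8 : (tunedParams α β N).k₀ * r ^ 12 ≤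
      r ^ 4 / 2 * Real.sqrt (Real.log N) * r ^ 12 := by
    have e1 : r ^ 4 / 2 * Real.sqrt (Real.log N) * r ^ 12 =
      r ^ 16 * Real.sqrt (Real.log N) / 2 := by ring
    have e2 : (tunedParams α β N).k₀ * r ^ 12 = (tunedParams α β N).k₀ * r ^ 5 * r ^ 7 := by ring
    rw [e1, e2]
    linarith
  exact le_of_mul_le_mul_right h8 h7

end Estimates

-- The constants are fixed in the order `T`, `κ`, `ε`, each using part of the gap between `c` and
-- the rate constant. Only then is `N` taken large, after which every condition follows from `tuning
-- N` being small or `tuning N ^ 8 * log N` large.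
set_option maxHeartbeats 1000000 in
theorem eventually_regular {α β : ℝ} (hβ : 0 < β) (hβα : β < α) (hα : α < 1) {c : ℝ} (hc : 0 ≤ c)
    (hc' : c < rateConst α β) :
    ∃ s₀ T κ ε : ℝ, ∀ᶠ N in atTop, (tunedParams α β N).Regular s₀ T κ c ε := by
  obtain ⟨s₀, hs0, hs1, hs⟩ := exists_sin_lower_bound hβ hβα hα
  rw [rateConst_eq hβ hβα hα] at hc'
  have hd : 0 < theta α - theta β := sub_pos.mpr (theta_strictMono hβ.le hβα hα.le)
  set d := theta α - theta β with hddef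
  obtain ⟨T, hT1, hT⟩ : ∃ T : ℝ, 1 ≤ T ∧ c < d ^ 2 * ((1 - 2 / (1 + T)) ^ 2 / 2) := by
    have h1 : Tendsto (fun T : ℝ => d ^ 2 * ((1 - 2 / (1 + T)) ^ 2 / 2)) atTop
        (𝓝 (d ^ 2 * ((1 - 0) ^ 2 / 2))) := by
      have h2 : Tendsto (fun T : ℝ => 2 / (1 + T)) atTop (𝓝 0) :=
        Tendsto.div_atTop tendsto_const_nhds (tendsto_atTop_add_const_left _ 1 tendsto_id)
      exact (((h2.const_sub 1).pow 2).div_const 2).const_mul _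
    have h3 := h1.eventually (lt_mem_nhds (show c < d ^ 2 * ((1 - 0) ^ 2 / 2) by linarith))
    obtain ⟨T, h4, h5⟩ := ((eventually_ge_atTop 1).and h3).exists
    exact ⟨T, h4, h5⟩
  obtain ⟨κ, hκ0, hκ1, hκ⟩ : ∃ κ : ℝ, 0 < κ ∧ κ ≤ 1 ∧
      c < d ^ 2 * ((1 - 2 / (1 + T)) ^ 2 / 2 - 4 * κ * (T + 1) ^ 2) := by
    have h1 : Continuous fun κ : ℝ =>
        d ^ 2 * ((1 - 2 / (1 + T)) ^ 2 / 2 - 4 * κ * (T + 1) ^ 2) := by fun_prop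
    have h2 := (h1.tendsto 0).eventually (lt_mem_nhds (by simpa using hT))
    have h3 : ∀ᶠ κ : ℝ in 𝓝[>] 0, κ ≤ 1 :=
      eventually_nhdsWithin_of_eventually_nhds (eventually_le_nhds one_pos)
    obtain ⟨κ, h4, h5, h6⟩ := ((h2.filter_mono nhdsWithin_le_nhds).and
      (h3.and self_mem_nhdsWithin)).exists
    exact ⟨κ, h6, h5, h4⟩
  set A := d ^ 2 * ((1 - 2 / (1 + T)) ^ 2 / 2 - 4 * κ * (T + 1) ^ 2) with hA
  set ε := (A - c) / 2 with hε
  have hε0 : 0 < ε := by linarith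
  have hnear : ∀ᶠ N in atTop, c + ε < (1 - tuning N) ^ 2 * A := by
    have h1 : Tendsto (fun N => (1 - tuning N) ^ 2 * A) atTop (𝓝 ((1 - 0) ^ 2 * A)) :=
      ((tendsto_tuning.const_sub 1).pow 2).mul_const A
    exact h1.eventually (lt_mem_nhds (by linarith))
  refine ⟨s₀, T, κ, ε, ?_⟩
  have hsmall : ∀ δ : ℝ, 0 < δ → ∀ᶠ N in atTop, tuning N ≤ δ := fun δ hδ =>
    tendsto_tuning.eventually (eventually_le_nhds hδ)
  have hlarge : ∀ C : ℝ, ∀ᶠ N in atTop, C ≤ tuning N ^ 8 * Real.log N := fun C =>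
    tendsto_tuning_pow_mul_log.eventually_ge_atTop C
  filter_upwards [hnear, hsmall (1 / 2056) (by norm_num), hsmall ((α - β) / 4) (by linarith),
    hsmall (d / 2 / (d + 2 / s₀)) (by positivity), hlarge 1, hlarge (48 * c),
    hlarge (64 * (2 * Real.exp (T + 1) * c)), hlarge 128,
    hlarge ((T + 1) * d / (κ * s₀ / 2)), hlarge ((c + ε) / ((κ * s₀ ^ 2) ^ 2 / 6)),
    hlarge (2 / ε), hlarge (1 + T), hlarge (3 * c / (((α - β) / 2) ^ 2 / 2)),
    hlarge (3 * c / ((s₀ * (d / 2)) ^ 2 / 2))]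
    with N c1 c2 c3 c4 c5 c6 c7 c8 c9 c10 c11 c12 c13 c14
  have hr0 := tuning_pos N
  have hr1 := tuning_lt_one N
  set r := tuning N with hrdef
  set L := Real.log N with hL
  have hpow : ∀ n : ℕ, r ^ n ≤ 1 := fun n => pow_le_one₀ hr0.le hr1.le
  have hL0 : 0 ≤ L := Real.log_natCast_nonneg N
  have hrL : r ^ 8 * L ≤ L := mul_le_of_le_one_left hL0 (hpow 8)
  have hL1 : 1 ≤ L := c5.trans hrL
  have hLpos : 0 < L := by linarith
  have hLsq : L ≤ L ^ 2 := by nlinarith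
  have hr8 : r ^ 8 * L ≤ r ^ 8 * L ^ 2 := by gcongr
  have hrr : ∀ n m : ℕ, n ≤ m → r ^ m ≤ r ^ n := fun n m hnm =>
    pow_le_pow_of_le_one hr0.le hr1.le hnm
  have hdiv : ∀ x y : ℝ, 0 < y → x / y ≤ r ^ 8 * L → x / L ^ 2 ≤ y := by
    intro x y hy hxy
    rw [div_le_iff₀ hy] at hxy
    rw [div_le_iff₀ (by positivity), mul_comm]
    refine hxy.trans (mul_le_mul_of_nonneg_right ?_ hy.le)
    linarith
  have hb₀ : 1 ≤ (tunedParams α β N).b₀ * r ^ 4 := by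
    have h1 := tunedParams_b₀_ge (α := α) (β := β) (N := N)
    calc 1 ≤ r ^ 8 * L ^ 2 := c5.trans hr8
      _ ≤ r ^ 6 * L ^ 2 := mul_le_mul_of_nonneg_right (hrr 6 8 (by norm_num)) (by positivity)
      _ = r ^ 2 * L ^ 2 * r ^ 4 := by ring
      _ ≤ _ := by gcongr
  have hb₀1 : 1 ≤ (tunedParams α β N).b₀ := by
    rcases Nat.eq_zero_or_pos (tunedParams α β N).b₀ with h0 | h0
    · rw [h0] at hb₀; norm_num at hb₀
    · exact h0
  exact
  { β_pos := hβ
    β_lt_α := hβα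
    α_lt_one := hα
    s₀_pos := hs0
    s₀_le_one := hs1
    s₀_le_sin := hs
    one_le_T := hT1
    κ_pos := hκ0
    κ_le_one := hκ1
    c_nonneg := hc
    ε_pos := hε0
    ϱ_pos := pow_pos hr0 4
    ϱ_le_one := hpow 4
    ϱ₂_pos := hr0
    ϱ₂_lt_one := hr1
    one_le_log := hL1
    one_le_b₀_mul := hb₀
    k₀_div_le := tunedParams_k₀_div_le hL1 hb₀1 c2
    four_ϱ_le := by
      change 4 * r ^ 4 ≤ α - β
      have := hrr 1 4 (by norm_num)
      linarith
    angle_gap := by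
      change d * (1 - r) * (1 + r ^ 4) + 2 * r ^ 4 / s₀ + d * r / 2 ≤ d
      rw [le_div_iff₀ (by positivity)] at c4
      have h1 : r ^ 3 ≤ r := by simpa using hrr 1 3 (by norm_num)
      have h2 : r ^ 3 * (d + 2 / s₀) ≤ d / 2 :=
        (mul_le_mul_of_nonneg_right h1 (by positivity)).trans c4
      have h3 := mul_le_mul_of_nonneg_left h2 hr0.le
      -- The factor `1 - ϱ₂` saves `d r`: half is kept as margin, the other half absorbs `r⁴ (d + 2
      -- / s₀)`.
      have h4 : 0 ≤ d * r ^ 5 := by positivity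
      have e : d * (1 - r) * (1 + r ^ 4) + 2 * r ^ 4 / s₀ + d * r / 2 =
        d - d * r / 2 - d * r ^ 5 + r * (r ^ 3 * (d + 2 / s₀)) := by ring
      rw [e]
      linarith
    early_rate := by
      change 3 * c / L ^ 2 ≤ 1 / (16 * L)
      rw [div_le_div_iff₀ (by positivity) (by positivity)]
      have h1 := mul_le_mul_of_nonneg_right (c6.trans hrL) hL0
      linarith
    middle_rate := by
      change 2 * Real.exp (T + 1) * c / L ^ 2 ≤ (r ^ 4) ^ 2 / 64
      rw [div_le_div_iff₀ (by positivity) (by norm_num)]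
      have e : (r ^ 4) ^ 2 * L ^ 2 = r ^ 8 * L ^ 2 := by ring
      rw [e]
      linarith
    middle_small := by
      change 2 * L ≤ L ^ 4 * (r ^ 4) ^ 2 / 64
      have e : L ^ 4 * (r ^ 4) ^ 2 / 64 = (r ^ 8 * L) * L ^ 2 * L / 64 := by ring
      rw [e]
      have h1 : 128 * 1 ≤ (r ^ 8 * L) * L ^ 2 :=
        mul_le_mul c8 (by linarith) zero_le_one (by positivity)
      have h2 := mul_le_mul_of_nonneg_right h1 hL0
      linarith
    tilt_small := by
      change (T + 1) * (d / L) ≤ κ * s₀ / 2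
      rw [div_le_iff₀ (by positivity)] at c9
      rw [← mul_div_assoc, div_le_iff₀ hLpos]
      have := mul_le_mul_of_nonneg_right hrL (show 0 ≤ κ * s₀ / 2 by positivity)
      linarith
    far_rate := hdiv _ _ (by positivity) c10
    near_rate := by
      change c + ε ≤ d ^ 2 * (1 - r) ^ 2 * _
      refine c1.le.trans (le_of_eq ?_)
      rw [hA]; ring
    late_small := by
      change 2 * L ≤ ε * L ^ 2
      have h1 := c11.trans hrL
      rw [div_le_iff₀ hε0] at h1
      have h2 := mul_le_mul_of_nonneg_right h1 hL0
      linarith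
    T_le := by
      change 1 + T ≤ L ^ 4
      exact (c12.trans hrL).trans (le_self_pow₀ hL1 (by norm_num))
    alive_early := hdiv _ _ (by
      have : 0 < α - β := by linarith
      positivity) c13
    alive_late := by
      change 3 * c / L ^ 2 ≤ (s₀ * (d * r / 2)) ^ 2 / 2
      rw [div_le_iff₀ (by positivity)] at c14
      rw [div_le_iff₀ (by positivity)]
      have e : (s₀ * (d * r / 2)) ^ 2 / 2 * L ^ 2 = r ^ 2 * L ^ 2 * ((s₀ * (d / 2)) ^ 2 / 2) := by
        ring
      rw [e]
      refine c14.trans (mul_le_mul_of_nonneg_right (hr8.trans ?_) (by positivity))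
      exact mul_le_mul_of_nonneg_right (hrr 2 8 (by norm_num)) (by positivity) }

/-! ### Limits that bring the expected rejection weight down to one -/

/-- The exponent is essentially `c ϱ₁`. So `ϱ₁ → 0` makes a rejection at the first checkpoint
asymptotically free of charge. -/
theorem tendsto_exp_rate_mul_b₀ (α β : ℝ) (c : ℝ) :
    Tendsto (fun N : ℕ => Real.exp (c / Real.log N ^ 2 * (tunedParams α β N).b₀)) atTop (𝓝 1) := by
  rw [← Real.exp_zero]
  refine (Real.continuous_exp.tendsto 0).comp ?_
  have hL2 : Tendsto (fun N : ℕ => Real.log N ^ 2) atTop atTop :=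
    (tendsto_pow_atTop (by norm_num)).comp tendsto_log_natCast
  have h1 : Tendsto (fun N : ℕ => (tunedParams α β N).b₀ / Real.log N ^ 2) atTop (𝓝 0) := by
    have h2 : Tendsto (fun N : ℕ => tuning N ^ 2 + 1 / Real.log N ^ 2) atTop (𝓝 (0 ^ 2 + 0)) :=
      (tendsto_tuning.pow 2).add (tendsto_const_nhds.div_atTop hL2)
    rw [zero_pow two_ne_zero, add_zero] at h2
    refine squeeze_zero' (Eventually.of_forall fun N => by positivity) ?_ h2
    filter_upwards [tendsto_log_natCast.eventually_ge_atTop 1] with N hN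
    rw [div_le_iff₀ (by positivity), add_mul, div_mul_cancel₀ _ (by positivity)]
    exact tunedParams_b₀_le
  have h3 := h1.const_mul c
  rw [mul_zero] at h3
  refine h3.congr fun N => ?_
  ring

theorem tendsto_k₀_mul_exp (α β : ℝ) :
    Tendsto (fun N : ℕ => (tunedParams α β N).k₀ *
      Real.exp (-((tunedParams α β N).b₀ / (16 * Real.log N)))) atTop (𝓝 0) := by
  have h1 : Tendsto (fun N : ℕ => 4112 / (tuning N ^ 8 * Real.log N)) atTop (𝓝 0) :=
    tendsto_const_nhds.div_atTop tendsto_tuning_pow_mul_log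
  refine squeeze_zero' (Eventually.of_forall fun N => by positivity) ?_ h1
  filter_upwards [tendsto_log_natCast.eventually_ge_atTop 1] with N hL
  have hr0 := tuning_pos N
  have hr1 := tuning_lt_one N
  have hb := tunedParams_b₀_ge (α := α) (β := β) (N := N)
  have hb1 : 1 ≤ (tunedParams α β N).b₀ := by
    have : (0 : ℝ) < (tunedParams α β N).b₀ := lt_of_lt_of_le (by positivity) hb
    exact_mod_cast this
  have hk := tunedParams_k₀_mul_le hL hb1
  set r := tuning N
  set L := Real.log N
  have hy : r ^ 2 * L / 16 ≤ (tunedParams α β N).b₀ / (16 * L) := by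
    rw [le_div_iff₀ (by positivity)]
    linarith
  have hexp : Real.exp (-((tunedParams α β N).b₀ / (16 * L))) ≤ 16 / (r ^ 2 * L) := by
    refine (Real.exp_le_exp.mpr (neg_le_neg hy)).trans ?_
    have e : 16 / (r ^ 2 * L) = (r ^ 2 * L / 16)⁻¹ := (inv_div _ _).symm
    rw [Real.exp_neg, e]
    refine inv_anti₀ (by positivity) ?_
    linarith [Real.add_one_le_exp (r ^ 2 * L / 16)]
  calc (tunedParams α β N).k₀ * Real.exp (-((tunedParams α β N).b₀ / (16 * L)))
      ≤ 257 / r ^ 5 * (16 / (r ^ 2 * L)) := by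
        refine mul_le_mul ?_ hexp (Real.exp_pos _).le (by positivity)
        rwa [le_div_iff₀ (by positivity)]
    _ = 4112 / (r ^ 7 * L) := by
        field_simp
        norm_num
    _ ≤ 4112 / (r ^ 8 * L) := by
        refine div_le_div_of_nonneg_left (by norm_num) (by positivity)
          (mul_le_mul_of_nonneg_right ?_ (by linarith))
        exact pow_le_pow_of_le_one hr0.le hr1.le (by norm_num)

theorem tendsto_exp_neg_b₀_mul (α β : ℝ) :
    Tendsto (fun N : ℕ => Real.exp (-((tunedParams α β N).b₀ * (tunedParams α β N).ϱ ^ 2 / 2)))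
      atTop (𝓝 0) := by
  refine Real.tendsto_exp_neg_atTop_nhds_zero.comp ?_
  refine tendsto_atTop_mono' _ ?_ (tendsto_tuning_pow_mul_log.atTop_div_const two_pos)
  filter_upwards [tendsto_tuning_pow_mul_log.eventually_ge_atTop 1] with N h1
  have hr0 := tuning_pos N
  have hr1 := tuning_lt_one N
  have hb := tunedParams_b₀_ge (α := α) (β := β) (N := N)
  change _ ≤ (tunedParams α β N).b₀ * (tuning N ^ 4) ^ 2 / 2
  set r := tuning N
  set L := Real.log N
  have h2 : r ^ 8 * L ≤ r ^ 2 * L ^ 2 * (r ^ 4) ^ 2 := by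
    calc r ^ 8 * L ≤ (r ^ 8 * L) * (r ^ 8 * L) := le_mul_of_one_le_left (by linarith) h1
      _ = r ^ 16 * L ^ 2 := by ring
      _ ≤ r ^ 10 * L ^ 2 := mul_le_mul_of_nonneg_right
          (pow_le_pow_of_le_one hr0.le hr1.le (by norm_num)) (sq_nonneg L)
      _ = _ := by ring
  have h3 : r ^ 2 * L ^ 2 * (r ^ 4) ^ 2 ≤ (tunedParams α β N).b₀ * (r ^ 4) ^ 2 := by gcongr
  linarith

theorem eventually_weight_bounds (α β c : ℝ) {s : ℝ} (hs : 0 < s) (hs1 : s ≤ 1) :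
    ∀ᶠ N : ℕ in atTop,
      Real.exp (c / Real.log N ^ 2 * (tunedParams α β N).b₀) + (tunedParams α β N).k₀ *
          Real.exp (-((tunedParams α β N).b₀ / (16 * Real.log N))) + Real.exp (-Real.log N) ≤
        1 + s ∧
      Real.exp (c / Real.log N ^ 2 * (tunedParams α β N).b₀) *
          Real.exp (-((tunedParams α β N).b₀ * (tunedParams α β N).ϱ ^ 2 / 2)) +
        (tunedParams α β N).k₀ * Real.exp (-((tunedParams α β N).b₀ / (16 * Real.log N))) +
        Real.exp (-Real.log N) ≤ s := by
  have h1 := (tendsto_exp_rate_mul_b₀ α β c).eventually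
    (eventually_le_nhds (show (1 : ℝ) < 1 + s / 3 by linarith))
  have h2 := (tendsto_k₀_mul_exp α β).eventually
    (eventually_le_nhds (show (0 : ℝ) < s / 3 by linarith))
  have h3 := (Real.tendsto_exp_neg_atTop_nhds_zero.comp tendsto_log_natCast).eventually
    (eventually_le_nhds (show (0 : ℝ) < s / 3 by linarith))
  have h4 := (tendsto_exp_neg_b₀_mul α β).eventually
    (eventually_le_nhds (show (0 : ℝ) < s / 6 by linarith))
  filter_upwards [h1, h2, h3, h4] with N h1 h2 h3 h4
  simp only [Function.comp_apply] at h3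
  refine ⟨by linarith, ?_⟩
  have h5 := mul_le_mul h1 h4 (Real.exp_pos _).le (by linarith)
  nlinarith

theorem tendsto_log_correction :
    Tendsto (fun N : ℕ => (2 * Real.log N + 1) * (Real.log N ^ 2 / N)) atTop (𝓝 0) := by
  have h : ∀ n : ℕ, Tendsto (fun N : ℕ => Real.log N ^ n / N) atTop (𝓝 0) := fun n =>
    (Real.isLittleO_pow_log_id_atTop (n := n)).tendsto_div_nhds_zero.comp
      tendsto_natCast_atTop_atTop
  have h1 := ((h 3).const_mul 2).add (h 2)
  rw [mul_zero, add_zero] at h1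
  refine h1.congr fun N => ?_
  ring

theorem mainTheorem2 (α β : ℝ) (hβ : 0 < β) (hβα : β < α) (hα : α < 1) :
    rateConst α β = (Real.arccos (1 - 2 * α) - Real.arccos (1 - 2 * β)) ^ 2 / 2 ∧
    ∃ ϱ ϱ₁ ϱ₂ : ℕ → ℝ,
      (∀ N, 0 < ϱ N ∧ ϱ N < ϱ₁ N ∧ ϱ₁ N < ϱ₂ N ∧ ϱ₂ N < 1) ∧
      Tendsto ϱ₂ atTop (𝓝 0) ∧
      ∀ η : ℝ, 0 < η → η < 1 →
        ∀ (μ : ℕ → Measure ℝ) [∀ N, IsProbabilityMeasure (μ N)],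
          (∀ N, μ N (Set.Icc 0 1) = 1) →
          (∀ N, α ≤ quantile (μ N) (1 - η)) →
          ((rateConst α β : ℝ) : EReal) ≤
            limsup (fun N : ℕ =>
              -ENNReal.log
                  ((Params.algorithm ⟨N, α, β, ϱ N, ϱ₁ N, ϱ₂ N⟩).failureProb N (μ N) β)
                * ((Real.log N ^ 2 / N : ℝ) : EReal)) atTop := by
  refine ⟨rateConst_eq hβ hβα hα, fun N => tuning N ^ 4, fun N => tuning N ^ 2, tuning,
    fun N => ?_, tendsto_tuning, ?_⟩
  · have h0 := tuning_pos N
    have h1 := tuning_lt_one N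
    refine ⟨by positivity, pow_lt_pow_right_of_lt_one₀ h0 h1 (by norm_num), ?_, h1⟩
    simpa using pow_lt_pow_right_of_lt_one₀ h0 h1 (show 1 < 2 by norm_num)
  intro η hη0 hη1 μ _ hμ hq
  rw [← EReal.ge_of_forall_gt_iff_ge]
  intro z hz
  rw [EReal.coe_lt_coe_iff] at hz
  have hpos : 0 < rateConst α β := by
    rw [rateConst_eq hβ hβα hα]
    have := theta_strictMono hβ.le hβα hα.le
    have : 0 < theta α - theta β := by linarith
    positivity
  -- A rate strictly between `z` and the rate constant: the lower gap absorbs the polynomial factor,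
  -- the upper one the errors of the path bound. The maximum with `0` makes `c` nonnegative.
  obtain ⟨c, hc1, hc2⟩ := exists_between (max_lt hpos hz)
  have hc0 : 0 ≤ c := (le_max_left 0 z).trans hc1.le
  have hzc : z < c := (le_max_right 0 z).trans_lt hc1
  obtain ⟨s₀, T, κ, ε, hreg⟩ := eventually_regular hβ hβα hα hc0 hc2
  refine Filter.le_limsup_of_frequently_le (Eventually.frequently ?_)
  filter_upwards [hreg, eventually_weight_bounds α β c hη0 hη1.le,
    tendsto_log_correction.eventually (eventually_le_nhds (show 0 < c - z by linarith))]
    with N hR hw hcor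
  -- Here `s = η`. The tuning does not depend on `η`; only the size of `N` from which the bound
  -- holds does, and that is uniform over the reservoirs.
  have hF : (tunedParams α β N).algorithm.failureProb N (μ N) β ≤ ENNReal.ofReal
      (Real.exp (2 * Real.log N + 1 - c / Real.log N ^ 2 * N)) :=
    hR.failureProb_le (hμ N) hη1 (hq N) hη0.le le_rfl hw.1 hw.2
  have hlog := ENNReal.log_monotone hF
  rw [ENNReal.log_ofReal_of_pos (Real.exp_pos _), Real.log_exp, ← EReal.neg_le_neg_iff,
    ← EReal.coe_neg] at hlog
  have hnn : (0 : EReal) ≤ ((Real.log N ^ 2 / N : ℝ) : EReal) := by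
    exact_mod_cast (by positivity : (0 : ℝ) ≤ Real.log N ^ 2 / N)
  refine le_trans ?_ (mul_le_mul_of_nonneg_right hlog hnn)
  rw [← EReal.coe_mul, EReal.coe_le_coe_iff]
  have hL : 1 ≤ Real.log N := hR.one_le_log
  have hN : (0 : ℝ) < N := by
    have : Real.exp (Real.log N) = N := hR.exp_log
    rw [← this]
    exact Real.exp_pos _
  have e : -(2 * Real.log N + 1 - c / Real.log N ^ 2 * N) * (Real.log N ^ 2 / N) =
      c - (2 * Real.log N + 1) * (Real.log N ^ 2 / N) := by
    field_simp
    ring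
  rw [e]
  linarith
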